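/- **Setting.** Let $m=(m_0,m_1,\dots)$ be a bounded sequence of integers $m_k\ge 2$, and let $G_m=\prod_{k\ge 0} Z_{m_k}$ be the associated (bounded) Vilenkin group, with normalized Haar measure $\mu$ (the product of the uniform measures on the cyclic groups $Z_{m_k}$). Put $M_0=1$, $M_{k+1}=m_kM_k$, and write each $n\in\mathbb N=\{0,1,2,\dots\}$ as $n=\sum_k n_kM_k$ with $0\le n_k<m_k$. The Vilenkin functions are $\psi_n(x)=\prod_k r_k(x)^{n_k}$ with $r_k(x)=\exp(2\pi i x_k/m_k)$. Let $\mathcal F_n$ be the $\sigma$-algebra generated by the sets $I_n(x)=\{y\in G_m: y_0=x_0,\dots,y_{n-1}=x_{n-1}\}$, $x\in G_m$. For $0<p<1$, the martingale Hardy space $H_p(G_m)$ consists of the complex martingales $f=(f^{(n)})_{n\in\mathbb N}$ with respect to $(\mathcal F_n)$ such that $\|f\|_{H_p}:=\|\sup_n|f^{(n)}|\,\|_p<\infty$, where $\|g\|_p=(\int_{G_m}|g|^p\,d\mu)^{1/p}$. For such $f$ let $$\widehat f(i)=\lim_{k\to\infty}\int_{G_m} f^{(k)}\overline{\psi_i}\,d\mu,\qquad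 S_nf=\sum_{k=0}^{n-1}\widehat f(k)\psi_k,\qquad L_nf=\frac1{l_n}\sum_{k=1}^{n-1}\frac{S_kf}{n-k}\quad (n\ge 2),\qquad l_n=\sum_{k=1}^{n-1}\frac1k,$$ and $L_0f=L_1f=0$. The $L_nf$ are the Nörlund logarithmic means. An operator $T$ on $H_p(G_m)$ is bounded from $H_p(G_m)$ to $L_p(G_m)$ if there is a finite constant $C$ with $\|Tf\|_p\le C\|f\|_{H_p}$ for all $f\in H_p(G_m)$. **Theorem.** Let $0<p<1$. a) The maximal operator $$f\mapsto \sup_{n\in\mathbb N}\frac{|L_nf|}{(n+1)^{1/p-1}}$$ is bounded from $H_p(G_m)$ to $L_p(G_m)$. b) Let $\varphi:\{1,2,\dots\}\to[1,\infty)$ be a non-decreasing function with $$\limsup_{n\to\infty}\frac{n^{1/p-1}}{\log n\cdot\varphi(n)}=+\infty.$$ Then the maximal operator $$f\mapsto \sup_{n\in\mathbb N}\frac{|L_nf|}{\varphi(n+1)}$$ is not bounded from $H_p(G_m)$ to $L_p(G_m)$; moreover, there exists a martingale $f\in H_p(G_m)$ such that $$\Big\|\sup_{n\in\mathbb N}\frac{|L_nf|}{\varphi(n+1)}\Big\|_p=\infty.$$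 -/

import Mathlib

open MeasureTheory Filter Topology
open scoped ENNReal NNReal ComplexConjugate

namespace Vilenkin

/-- The group `G_m`: the complete direct product of the cyclic groups `Z_{m_k}`, with the
product topology and product `σ`-algebra. -/
abbrev Group (m : ℕ → ℕ) : Type := ∀ k : ℕ, ZMod (m k)

/-- The generalized number system: `M_0 = 1`, `M_{k+1} = m_k M_k`. -/
def bigM (m : ℕ → ℕ) : ℕ → ℕ
  | 0 => 1
  | k + 1 => m k * bigM m k

/-- The `k`-th digit `n_k` in the expansion `n = ∑ k, n_k M_k`, `0 ≤ n_k < m_k`. -/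
def digit (m : ℕ → ℕ) (n k : ℕ) : ℕ := n / bigM m k % m k

section

variable (m : ℕ → ℕ)

/-- The uniform probability measure on `Z_{m_k}`, giving mass `1 / m_k` to each point. -/
noncomputable def coordMeasure (k : ℕ) : Measure (ZMod (m k)) :=
  (m k : ℝ≥0∞)⁻¹ • Measure.count

instance [∀ k, NeZero (m k)] (k : ℕ) : IsProbabilityMeasure (coordMeasure m k) := by
  constructor
  have h0 : (m k : ℝ≥0∞) ≠ 0 := by exact_mod_cast NeZero.ne (m k)
  simp [coordMeasure, Measure.count_univ, ENat.card_eq_coe_fintype_card, ZMod.card,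
    ENNReal.inv_mul_cancel h0 (ENNReal.natCast_ne_top _)]

/-- The normalized Haar measure `μ` of `G_m`: the product of the uniform measures. -/
noncomputable def haar [∀ k, NeZero (m k)] : Measure (Group m) :=
  Measure.infinitePi (coordMeasure m)

/-- The interval `I_n(x) = {y : y_0 = x_0, …, y_{n-1} = x_{n-1}}`. -/
def interval (n : ℕ) (x : Group m) : Set (Group m) := {y | ∀ k < n, y k = x k}

variable {m} in
theorem measurableSet_interval (n : ℕ) (x : Group m) : MeasurableSet (interval m n x) := by
  have : interval m n x = ⋂ k, ⋂ _ : k < n, (fun y : Group m => y k) ⁻¹' {x k} := by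
    ext y; simp [interval]
  rw [this]
  exact MeasurableSet.iInter fun k => MeasurableSet.iInter fun _ =>
    (measurable_pi_apply k) (measurableSet_singleton _)

/-- The filtration `(F_n)`, where `F_n` is generated by the intervals `I_n(x)`, `x ∈ G_m`. -/
def filtration [∀ k, NeZero (m k)] : Filtration ℕ (inferInstance : MeasurableSpace (Group m)) where
  seq n := MeasurableSpace.generateFrom (Set.range (interval m n))
  mono' := by
    intro n n' hnn'
    refine MeasurableSpace.generateFrom_le ?_
    rintro _ ⟨x, rfl⟩
    -- the interval of order `n` is the union of the finitely many intervals of order `n'` inside it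
    have hfin : (Set.range (interval m n')).Finite := by
      refine (Set.finite_range (fun z : (∀ i : Fin n', ZMod (m i)) =>
        {y : Group m | ∀ i : Fin n', y i = z i})).subset ?_
      rintro _ ⟨y, rfl⟩
      refine ⟨fun i => y i, ?_⟩
      ext w
      exact ⟨fun h k hk => h ⟨k, hk⟩, fun h i => h i i.2⟩
    have hU : interval m n x = ⋃₀ (interval m n' '' interval m n x) := by
      ext y
      constructor
      · intro hy
        exact ⟨_, ⟨y, hy, rfl⟩, fun k _ => rfl⟩
      · rintro ⟨_, ⟨z, hz, rfl⟩, hy⟩ k hk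
        rw [hy k (hk.trans_le hnn'), hz k hk]
    rw [hU]
    refine MeasurableSet.sUnion (hfin.subset (Set.image_subset_range _ _)).countable ?_
    rintro _ ⟨z, _, rfl⟩
    exact MeasurableSpace.measurableSet_generateFrom ⟨z, rfl⟩
  le' := by
    intro n
    refine MeasurableSpace.generateFrom_le ?_
    rintro _ ⟨x, rfl⟩
    exact measurableSet_interval n x

/-- The generalized Rademacher function `r_k(x) = exp(2πi x_k / m_k)`, `0 ≤ x_k < m_k`. -/
noncomputable def rademacher (k : ℕ) (x : Group m) : ℂ :=
  Complex.exp (2 * Real.pi * Complex.I * ((x k).val : ℂ) / (m k : ℂ))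

/-- The Vilenkin function `ψ_n = ∏ k, r_k ^ n_k`. As all `m_k ≥ 2`, we have `n < M_k`, and hence
`n_k = 0`, for `k ≥ n`: the product over `k < n` is the whole product. -/
noncomputable def psi (n : ℕ) (x : Group m) : ℂ :=
  ∏ k ∈ Finset.range n, rademacher m k x ^ digit m n k

variable [∀ k, NeZero (m k)]

/-- The `i`-th Vilenkin-Fourier coefficient of a martingale `f`: the limit of the coefficients
of the functions `f^{(k)}` (a sequence that is constant from some `k` on). -/
noncomputable def fourierCoeff (f : ℕ → Group m → ℂ) (i : ℕ) : ℂ :=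
  limUnder atTop fun k : ℕ => ∫ x, f k x * conj (psi m i x) ∂(haar m)

/-- The partial sum `S_n f = ∑_{k < n} f̂(k) ψ_k`. -/
noncomputable def partialSum (f : ℕ → Group m → ℂ) (n : ℕ) (x : Group m) : ℂ :=
  ∑ k ∈ Finset.range n, fourierCoeff m f k * psi m k x

/-- The Nörlund logarithmic mean `L_n f = (1 / l_n) ∑_{k=1}^{n-1} S_k f / (n - k)`, with
`l_n = ∑_{k=1}^{n-1} 1 / k`, for `n ≥ 2`; for `n = 0, 1` (empty sums) the value is `0`. -/
noncomputable def norlundLogMean (f : ℕ → Group m → ℂ) (n : ℕ) (x : Group m) : ℂ :=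
  (∑ k ∈ Finset.Ico 1 n, partialSum m f k x / ((n : ℂ) - (k : ℂ))) /
    ∑ k ∈ Finset.Ico 1 n, (1 : ℂ) / (k : ℂ)

/-- The weighted maximal operator `sup_n |L_n f| / w_n`, for positive weights `w_n`,
with values in `[0, ∞]`. -/
noncomputable def weightedMax (w : ℕ → ℝ) (f : ℕ → Group m → ℂ) (x : Group m) : ℝ≥0∞ :=
  ⨆ n : ℕ, ‖norlundLogMean m f n x‖ₑ / ENNReal.ofReal (w n)

/-- The maximal function `f^* = sup_n |f^{(n)}|` of a martingale. -/
noncomputable def maximalFunction (f : ℕ → Group m → ℂ) (x : Group m) : ℝ≥0∞ :=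
  ⨆ n : ℕ, ‖f n x‖ₑ

/-- The Hardy quasi-norm `‖f‖_{H_p} = ‖f^*‖_p`. -/
noncomputable def hardyNorm (p : ℝ) (f : ℕ → Group m → ℂ) : ℝ≥0∞ :=
  eLpNorm (maximalFunction m f) (ENNReal.ofReal p) (haar m)

/-- Membership in the martingale Hardy space `H_p(G_m)`. -/
def MemHardy (p : ℝ) (f : ℕ → Group m → ℂ) : Prop :=
  Martingale f (filtration m) (haar m) ∧ hardyNorm m p f < ∞

/-- Boundedness of an operator `T`, with values in the nonnegative functions, from `H_p(G_m)`
to `L_p(G_m)`. -/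
def BoundedHardyLp (p : ℝ) (T : (ℕ → Group m → ℂ) → Group m → ℝ≥0∞) : Prop :=
  ∃ C : ℝ≥0, ∀ f : ℕ → Group m → ℂ, MemHardy m p f →
    eLpNorm (T f) (ENNReal.ofReal p) (haar m) ≤ C * hardyNorm m p f

end

end Vilenkin

/-! Write B for a bound of the `m k`, f* for the maximal function and l_n for the harmonic sum in
L_n. Part a). L_n f is a weighted average of the S_k f with k < n, so it suffices to dominate
partial sums. If n ≤ M_N, then S_n f(x) = ∫ f^(N) D_n(x - t), and |D_n| is at most B times the sum
over j ≤ N of M_j 1_{I_j(x)} (`norm_dirichletKernel_le_sum`). As f^(N) is constant on intervals of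
order N, its local L_1 norms are bounded by local L_p quasi-norms at the cost of M_N^(1/p-1)
(`setLIntegral_interval_le`), which is comparable with the weight. What remains is ∑_j M_j
(∫_{I_j(x)} f*^p)^(1/p), independent of n. Its p-th power has integral at most ∑_j M_j^(p-1) ∫ f*^p,
and this series converges because p < 1 (`lintegral_majorant_rpow_le`). Part b). One lacunary
martingale f = ∑ c_a M_a 1_{I_a(0)} r_a settles both claims. It lies in H_p once ∑ c_a^p M_a^(p-1)
is finite, and its coefficient at M_a is c_a. In L_n f with n = M_a + 2, the frequency M_a occurs
only in the last summand, whose weight is 1, so it contributes modulus c_a / l_n at every point; the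
rest is bounded by the S_j f with j ≤ M_a (`le_norm_norlundLogMean`). A long gap below a bounds
these by a constant fixed before a is chosen (`norm_partialSum_le_of_eq`). With c_a = θ^k
M_a^(1/p-1), the limsup hypothesis lets the main term beat φ and that constant (`exists_level`). -/

namespace Vilenkin

/-! ### Mixed-radix digits. -/

section NumberSystem

variable (m : ℕ → ℕ)

theorem bigM_pos [∀ k, NeZero (m k)] (k : ℕ) : 0 < bigM m k := by
  induction k with
  | zero => exact one_pos
  | succ k ih => exact Nat.mul_pos (NeZero.pos (m k)) ih

theorem bigM_dvd {j k : ℕ} (h : j ≤ k) : bigM m j ∣ bigM m k := by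
  induction k, h using Nat.le_induction with
  | base => exact dvd_rfl
  | succ k _ ih => exact ih.mul_left _

theorem bigM_mono [∀ k, NeZero (m k)] : Monotone (bigM m) := fun _ k h =>
  Nat.le_of_dvd (bigM_pos m k) (bigM_dvd m h)

theorem two_pow_le_bigM (hm : ∀ k, 2 ≤ m k) (k : ℕ) : 2 ^ k ≤ bigM m k := by
  induction k with
  | zero => exact le_rfl
  | succ k ih => rw [pow_succ, mul_comm]; exact Nat.mul_le_mul (hm k) ih

theorem lt_bigM (hm : ∀ k, 2 ≤ m k) (k : ℕ) : k < bigM m k :=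
  Nat.lt_two_pow_self.trans_le (two_pow_le_bigM m hm k)

theorem bigM_eq_prod (N : ℕ) : bigM m N = ∏ k ∈ Finset.range N, m k := by
  induction N with
  | zero => rfl
  | succ N ih => rw [Finset.prod_range_succ, ← ih, mul_comm]; rfl

theorem digit_eq_zero_of_lt {n k : ℕ} (h : n < bigM m k) : digit m n k = 0 := by
  simp [digit, Nat.div_eq_of_lt h]

theorem digit_mul_bigM_of_lt [∀ k, NeZero (m k)] (q : ℕ) {k K : ℕ} (h : k < K) :
    digit m (q * bigM m K) k = 0 := by
  obtain ⟨c, hc⟩ := bigM_dvd m (Nat.succ_le_of_lt h)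
  have : q * bigM m K = bigM m k * (m k * (q * c)) := by
    rw [hc, bigM]; ring
  rw [digit, this, Nat.mul_div_cancel_left _ (bigM_pos m k), Nat.mul_mod_right]

/-- No carries occur: a multiple of M_K has digits only from position K on, and i only below K. -/
theorem digit_add [∀ k, NeZero (m k)] (q : ℕ) {i K : ℕ} (hi : i < bigM m K) (k : ℕ) :
    digit m (q * bigM m K + i) k = digit m (q * bigM m K) k + digit m i k := by
  rcases lt_or_ge k K with hk | hk
  · rw [digit_mul_bigM_of_lt m q hk, zero_add]
    obtain ⟨c, hc⟩ := bigM_dvd m (Nat.succ_le_of_lt hk)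
    have : q * bigM m K + i = i + bigM m k * (m k * (q * c)) := by
      rw [hc, bigM]; ring
    rw [digit, digit, this, Nat.add_mul_div_left _ _ (bigM_pos m k), Nat.add_mul_mod_self_left]
  · rw [digit_eq_zero_of_lt m (hi.trans_le (bigM_mono m hk)), add_zero]
    obtain ⟨c, hc⟩ := bigM_dvd m hk
    rw [digit, digit, hc, ← Nat.div_div_eq_div_mul, ← Nat.div_div_eq_div_mul, add_comm,
      Nat.add_mul_div_right _ _ (bigM_pos m K), Nat.div_eq_of_lt hi, zero_add,
      Nat.mul_div_cancel _ (bigM_pos m K)]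

theorem digit_mul_bigM [∀ k, NeZero (m k)] {q K : ℕ} (hq : q < m K) (k : ℕ) :
    digit m (q * bigM m K) k = if k = K then q else 0 := by
  rcases lt_trichotomy k K with h | rfl | h
  · rw [digit_mul_bigM_of_lt m q h, if_neg h.ne]
  · rw [if_pos rfl, digit, Nat.mul_div_cancel _ (bigM_pos m k), Nat.mod_eq_of_lt hq]
  · rw [if_neg h.ne']
    exact digit_eq_zero_of_lt m ((Nat.mul_lt_mul_of_pos_right hq (bigM_pos m K)).trans_le
      (bigM_mono m (Nat.succ_le_of_lt h)))

end NumberSystem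

/-! ### Rademacher and Vilenkin functions. -/

section Characters

variable (m : ℕ → ℕ)

theorem norm_rademacher (k : ℕ) (x : Group m) : ‖rademacher m k x‖ = 1 := by
  have : 2 * (Real.pi : ℂ) * Complex.I * ((x k).val : ℂ) / (m k : ℂ) =
      ((2 * Real.pi * (x k).val / m k : ℝ) : ℂ) * Complex.I := by
    push_cast; ring
  rw [rademacher, this, Complex.norm_exp_ofReal_mul_I]

theorem rademacher_ne_zero (k : ℕ) (x : Group m) : rademacher m k x ≠ 0 := by
  rw [← norm_ne_zero_iff, norm_rademacher]; exact one_ne_zero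

theorem rademacher_eq_pow [∀ k, NeZero (m k)] (k : ℕ) (x : Group m) :
    rademacher m k x = Complex.exp (2 * Real.pi * Complex.I / m k) ^ (x k).val := by
  rw [rademacher, ← Complex.exp_nat_mul]; congr 1; ring

theorem rademacher_pow_self [∀ k, NeZero (m k)] (k : ℕ) (x : Group m) :
    rademacher m k x ^ m k = 1 := by
  rw [rademacher_eq_pow, pow_right_comm,
    (Complex.isPrimitiveRoot_exp (m k) (NeZero.ne _)).pow_eq_one, one_pow]

theorem rademacher_eq_iff [∀ k, NeZero (m k)] (k : ℕ) (x y : Group m) :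
    rademacher m k x = rademacher m k y ↔ x k = y k := by
  refine ⟨fun h => ?_, fun h => by rw [rademacher, rademacher, h]⟩
  rw [rademacher_eq_pow, rademacher_eq_pow] at h
  exact ZMod.val_injective _ ((Complex.isPrimitiveRoot_exp (m k) (NeZero.ne _)).pow_inj
    (ZMod.val_lt _) (ZMod.val_lt _) h)

theorem conj_rademacher (k : ℕ) (x : Group m) :
    conj (rademacher m k x) = (rademacher m k x)⁻¹ :=
  (Complex.inv_eq_conj (norm_rademacher m k x)).symm

theorem norm_psi (n : ℕ) (x : Group m) : ‖psi m n x‖ = 1 := by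
  simp [psi, norm_prod, norm_rademacher]

/-- Frees the product from its index-dependent range, so that different ψ_n can be compared factor
by factor; the extra digits are zero. -/
theorem psi_eq_prod [∀ k, NeZero (m k)] (hm : ∀ k, 2 ≤ m k) {n N : ℕ} (h : n < bigM m N)
    (x : Group m) :
    psi m n x = ∏ k ∈ Finset.range N, rademacher m k x ^ digit m n k := by
  have key : ∀ N, n < bigM m N → ∏ k ∈ Finset.range N, rademacher m k x ^ digit m n k =
      ∏ k ∈ Finset.range (n + N), rademacher m k x ^ digit m n k := by
    intro N h
    refine Finset.prod_subset (Finset.range_mono (Nat.le_add_left N n)) fun k _ hk => ?_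
    rw [digit_eq_zero_of_lt m (h.trans_le (bigM_mono m (by simpa using hk))), pow_zero]
  rw [key N h, psi]
  refine Finset.prod_subset (Finset.range_mono (Nat.le_add_right n N)) fun k _ hk => ?_
  rw [digit_eq_zero_of_lt m ((lt_bigM m hm n).trans_le (bigM_mono m (by simpa using hk))),
    pow_zero]

theorem psi_add [∀ k, NeZero (m k)] (hm : ∀ k, 2 ≤ m k) (q : ℕ) {i K : ℕ}
    (hi : i < bigM m K) (x : Group m) :
    psi m (q * bigM m K + i) x = psi m (q * bigM m K) x * psi m i x := by
  have h := lt_bigM m hm (q * bigM m K + i)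
  rw [psi_eq_prod m hm h, psi_eq_prod m hm ((Nat.le_add_right _ _).trans_lt h),
    psi_eq_prod m hm ((Nat.le_add_left i _).trans_lt h), ← Finset.prod_mul_distrib]
  exact Finset.prod_congr rfl fun k _ => by rw [digit_add m q hi, pow_add]

theorem psi_mul_bigM [∀ k, NeZero (m k)] (hm : ∀ k, 2 ≤ m k) {q K : ℕ} (hq : q < m K)
    (x : Group m) : psi m (q * bigM m K) x = rademacher m K x ^ q := by
  rw [psi_eq_prod m hm (N := K + 1) (Nat.mul_lt_mul_of_pos_right hq (bigM_pos m K)),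
    Finset.prod_eq_single_of_mem K (Finset.self_mem_range_succ K), digit_mul_bigM m hq, if_pos rfl]
  intro k _ hk
  rw [digit_mul_bigM m hq, if_neg hk, pow_zero]

theorem psi_bigM [∀ k, NeZero (m k)] (hm : ∀ k, 2 ≤ m k) (K : ℕ) (x : Group m) :
    psi m (bigM m K) x = rademacher m K x := by
  simpa using psi_mul_bigM m hm (q := 1) (K := K) (hm K) x

theorem dependsOn_psi [∀ k, NeZero (m k)] (hm : ∀ k, 2 ≤ m k) {n N : ℕ} (h : n < bigM m N) :
    DependsOn (psi m n) (Set.Iio N) := by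
  intro x y hxy
  rw [psi_eq_prod m hm h, psi_eq_prod m hm h]
  refine Finset.prod_congr rfl fun k hk => ?_
  rw [(rademacher_eq_iff m k x y).2 (hxy k (by simpa using hk))]

theorem measurable_rademacher (k : ℕ) : Measurable (rademacher m k) :=
  (Measurable.of_discrete (f := fun z : ZMod (m k) =>
    Complex.exp (2 * Real.pi * Complex.I * (z.val : ℂ) / (m k : ℂ)))).comp (measurable_pi_apply k)

theorem measurable_psi (n : ℕ) : Measurable (psi m n) :=
  Finset.measurable_prod _ fun k _ => (measurable_rademacher m k).pow_const _

end Characters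

/-! ### Dirichlet kernels. -/

section Kernel

variable (m : ℕ → ℕ)

/-- The Dirichlet kernel `D_n(x - t) = ∑_{k < n} ψ_k(x) conj ψ_k(t)` as a function of two
variables. -/
noncomputable def dirichletKernel (n : ℕ) (x t : Group m) : ℂ :=
  ∑ k ∈ Finset.range n, psi m k x * conj (psi m k t)

theorem sum_range_mul {A : Type*} [AddCommMonoid A] (F : ℕ → A) (q M : ℕ) :
    ∑ k ∈ Finset.range (q * M), F k =
      ∑ s ∈ Finset.range q, ∑ i ∈ Finset.range M, F (s * M + i) := by
  induction q with
  | zero => simp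
  | succ q ih => rw [Finset.sum_range_succ, ← ih, add_mul, one_mul, Finset.sum_range_add]

theorem norm_dirichletKernel_le (n : ℕ) (x t : Group m) : ‖dirichletKernel m n x t‖ ≤ n := by
  refine (norm_sum_le _ _).trans_eq ?_
  simp [norm_psi]

variable [∀ k, NeZero (m k)]

/-- Splitting by the digit s at position k factors out the geometric sum of w^s, where w = r_k(x)
conj r_k(t) is an m_k-th root of unity other than 1. -/
theorem dirichletKernel_bigM_succ (hm : ∀ k, 2 ≤ m k) {k : ℕ} {x t : Group m}
    (h : x k ≠ t k) : dirichletKernel m (bigM m (k + 1)) x t = 0 := by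
  set w := rademacher m k x * conj (rademacher m k t) with hw
  have hw1 : w ≠ 1 := by
    rw [hw, conj_rademacher, ← div_eq_mul_inv, Ne, div_eq_one_iff_eq (rademacher_ne_zero m k t)]
    exact fun h' => h ((rademacher_eq_iff m k x t).1 h')
  have hwm : w ^ m k = 1 := by
    rw [hw, mul_pow, ← map_pow, rademacher_pow_self, rademacher_pow_self, map_one, one_mul]
  have hgeom : ∑ s ∈ Finset.range (m k), w ^ s = 0 := by
    rw [geom_sum_eq hw1, hwm, sub_self, zero_div]
  rw [dirichletKernel, bigM, sum_range_mul]
  calc _ = ∑ s ∈ Finset.range (m k), w ^ s * dirichletKernel m (bigM m k) x t := by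
        refine Finset.sum_congr rfl fun s hs => ?_
        rw [dirichletKernel, Finset.mul_sum]
        refine Finset.sum_congr rfl fun i hi => ?_
        rw [Finset.mem_range] at hs hi
        rw [psi_add m hm s hi, psi_add m hm s hi, psi_mul_bigM m hm hs, psi_mul_bigM m hm hs,
          map_mul, map_pow, hw, mul_pow]
        ring
    _ = 0 := by rw [← Finset.sum_mul, hgeom, zero_mul]

/-- Complete blocks of length M_{k+1} cancel; the remainder has fewer than M_{k+1} unimodular terms.
-/
theorem norm_dirichletKernel_le_bigM_succ (hm : ∀ k, 2 ≤ m k) (n : ℕ) {k : ℕ} {x t : Group m}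
    (h : x k ≠ t k) : ‖dirichletKernel m n x t‖ ≤ bigM m (k + 1) := by
  set M := bigM m (k + 1) with hM
  have hn : n = n / M * M + n % M := (Nat.div_add_mod' n M).symm
  have hlt : n % M < M := Nat.mod_lt _ (bigM_pos m _)
  have hblock : ∑ j ∈ Finset.range (n / M * M), psi m j x * conj (psi m j t) = 0 := by
    rw [sum_range_mul]
    refine Finset.sum_eq_zero fun s _ => ?_
    calc _ = psi m (s * M) x * conj (psi m (s * M) t) * dirichletKernel m M x t := by
          rw [dirichletKernel, Finset.mul_sum]
          refine Finset.sum_congr rfl fun i hi => ?_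
          rw [Finset.mem_range] at hi
          rw [psi_add m hm s hi, psi_add m hm s hi, map_mul]
          ring
      _ = 0 := by rw [dirichletKernel_bigM_succ m hm h, mul_zero]
  rw [dirichletKernel, hn, Finset.sum_range_add, hblock, zero_add]
  refine (norm_sum_le _ _).trans ?_
  simpa [norm_psi] using hlt.le

open Classical in
/-- For `n ≤ M_N`, the Dirichlet kernel is dominated by the kernels of the conditional
expectations. -/
theorem norm_dirichletKernel_le_sum (hm : ∀ k, 2 ≤ m k) {B : ℕ} (hB : ∀ k, m k ≤ B) {n N : ℕ}
    (hn : n ≤ bigM m N) (x t : Group m) :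
    ‖dirichletKernel m n x t‖ ≤
      B * ∑ j ∈ Finset.range (N + 1), if t ∈ interval m j x then (bigM m j : ℝ) else 0 := by
  have hB1 : (1 : ℝ) ≤ B := by
    exact_mod_cast (one_le_two.trans (hm 0)).trans (hB 0)
  have hpos : ∀ j, 0 ≤ if t ∈ interval m j x then (bigM m j : ℝ) else 0 := fun j => by
    split_ifs <;> positivity
  have key : ∀ j ≤ N, t ∈ interval m j x → (bigM m j : ℝ) ≤
      ∑ j ∈ Finset.range (N + 1), if t ∈ interval m j x then (bigM m j : ℝ) else 0 := by
    intro j hj ht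
    refine le_trans ?_ (Finset.single_le_sum (fun i _ => hpos i)
      (Finset.mem_range.2 (Nat.lt_succ_of_le hj)))
    rw [if_pos ht]
  by_cases h : t ∈ interval m N x
  · refine (norm_dirichletKernel_le m n x t).trans ((Nat.cast_le.2 hn).trans
      ((key N le_rfl h).trans (le_mul_of_one_le_left (Finset.sum_nonneg fun i _ => hpos i) hB1)))
  -- At the first coordinate k where t and x differ, t still lies in I_k(x), and the kernel is at
  -- most M_{k+1} ≤ B M_k.
  · have hex : ∃ k, k < N ∧ t k ≠ x k := by
      simpa [interval] using h
    have hk := Nat.find_spec hex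
    set k := Nat.find hex
    have hmem : t ∈ interval m k x := fun i hi => by
      by_contra hne
      exact Nat.find_min hex hi ⟨hi.trans hk.1, hne⟩
    refine (norm_dirichletKernel_le_bigM_succ m hm n hk.2.symm).trans ?_
    rw [bigM, Nat.cast_mul]
    exact mul_le_mul (Nat.cast_le.2 (hB k)) (key k hk.1.le hmem) (by positivity) (by positivity)

end Kernel

/-! ### Haar measure, translation invariance and orthogonality. -/

section Measure

theorem coordMeasure_map_add_right (m : ℕ → ℕ) (k : ℕ) (c : ZMod (m k)) :
    (coordMeasure m k).map (· + c) = coordMeasure m k := by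
  ext s hs
  rw [Measure.map_apply .of_discrete hs]
  have : Measure.count ((fun z : ZMod (m k) => z + c) ⁻¹' s) = Measure.count s := by
    rw [← Measure.count_injective_image (Equiv.addRight c).symm.injective s,
      Equiv.image_symm_eq_preimage]
    rfl
  simp only [coordMeasure, Measure.smul_apply, this]

variable (m : ℕ → ℕ)

theorem interval_eq_of_mem {N : ℕ} {x y : Group m} (h : y ∈ interval m N x) :
    interval m N y = interval m N x := by
  ext z
  exact ⟨fun hz k hk => (hz k hk).trans (h k hk), fun hz k hk => (hz k hk).trans (h k hk).symm⟩

theorem mem_interval_comm {N : ℕ} {x y : Group m} :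
    y ∈ interval m N x ↔ x ∈ interval m N y :=
  ⟨fun h k hk => (h k hk).symm, fun h k hk => (h k hk).symm⟩

theorem mem_interval_self (N : ℕ) (x : Group m) : x ∈ interval m N x := fun _ _ => rfl

theorem interval_anti (x : Group m) : Antitone fun N => interval m N x :=
  fun _ _ h _ hy k hk => hy k (hk.trans_le h)

variable [∀ k, NeZero (m k)]

theorem measurableSet_mem_interval (N : ℕ) :
    MeasurableSet {z : Group m × Group m | z.2 ∈ interval m N z.1} := by
  have : {z : Group m × Group m | z.2 ∈ interval m N z.1} =
      ⋂ k, ⋂ _ : k < N, (fun z : Group m × Group m => (z.1 k, z.2 k)) ⁻¹' {w | w.2 = w.1} := by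
    ext z; simp [interval]
  rw [this]
  exact MeasurableSet.iInter fun k => MeasurableSet.iInter fun _ =>
    (((measurable_pi_apply k).comp measurable_fst).prodMk
      ((measurable_pi_apply k).comp measurable_snd)) (measurableSet_eq_fun measurable_snd measurable_fst)

instance : IsProbabilityMeasure (haar m) := by
  unfold haar; infer_instance

theorem haar_interval (N : ℕ) (x : Group m) :
    haar m (interval m N x) = (bigM m N : ℝ≥0∞)⁻¹ := by
  have h : interval m N x = Set.pi (Finset.range N : Set ℕ) fun k => {x k} := by
    ext y; simp [interval]
  rw [h, haar, Measure.infinitePi_pi _ fun k _ => measurableSet_singleton _, bigM_eq_prod,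
    Nat.cast_prod, ENNReal.prod_inv_distrib]
  · simp [coordMeasure]
  · intro i _ j _ _
    exact Or.inr (ENNReal.natCast_ne_top _)

theorem bigM_mul_haar_interval (N : ℕ) (x : Group m) :
    bigM m N * haar m (interval m N x) = 1 := by
  rw [haar_interval]
  exact ENNReal.mul_inv_cancel (Nat.cast_ne_zero.2 (bigM_pos m N).ne') (ENNReal.natCast_ne_top _)

theorem measurePreserving_add_right (c : Group m) :
    MeasurePreserving (fun x : Group m => x + c) (haar m) (haar m) := by
  have hmeas : ∀ k, Measurable fun z : ZMod (m k) => z + c k := fun k => .of_discrete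
  refine ⟨measurable_pi_lambda _ fun k => (hmeas k).comp (measurable_pi_apply k), ?_⟩
  have := Measure.infinitePi_map_pi (μ := coordMeasure m) (f := fun k z => z + c k) hmeas
  simp only [coordMeasure_map_add_right] at this
  exact this

theorem integral_add_right (c : Group m) (f : Group m → ℂ) :
    ∫ x, f (x + c) ∂(haar m) = ∫ x, f x ∂(haar m) := by
  have h1 := measurePreserving_add_right m c
  have h2 := measurePreserving_add_right m (-c)
  let e : Group m ≃ᵐ Group m :=
    { Equiv.addRight c with
      measurable_toFun := h1.measurable
      measurable_invFun := h2.measurable }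
  exact MeasurePreserving.integral_comp' (f := e) h1 f

/-- A nontrivial power of a Rademacher function is orthogonal to all functions of the previous
coordinates. -/
theorem integral_mul_rademacher_pow {K s : ℕ} (hs0 : 0 < s) (hs : s < m K) {h : Group m → ℂ}
    (hh : DependsOn h (Set.Iio K)) :
    ∫ x, h x * rademacher m K x ^ s ∂(haar m) = 0 := by
  classical
  have h2 : 1 < m K := by omega
  have : Fact (1 < m K) := ⟨h2⟩
  -- Translation by c fixes h and multiplies r_K^s by w^s ≠ 1, so the integral equals w^s times
  -- itself.
  set c : Group m := Pi.single K 1 with hc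
  set w : ℂ := Complex.exp (2 * Real.pi * Complex.I / m K) with hw
  have hprim : IsPrimitiveRoot w (m K) := Complex.isPrimitiveRoot_exp (m K) (NeZero.ne _)
  have hshift : ∀ x, rademacher m K (x + c) = w * rademacher m K x := by
    intro x
    rw [rademacher_eq_pow, rademacher_eq_pow, ← hw]
    have : (x + c) K = x K + 1 := by simp [hc]
    rw [this, ZMod.val_add, ZMod.val_one, ← pow_eq_pow_mod _ hprim.pow_eq_one, pow_succ, mul_comm]
  have hinv : ∀ x, h (x + c) = h x := fun x => hh fun k hk => by
    have : k ≠ K := ne_of_lt hk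
    simp [hc, this]
  have key := integral_add_right m c fun x => h x * rademacher m K x ^ s
  simp only [hshift, hinv, mul_pow, mul_left_comm _ (w ^ s)] at key
  rw [integral_const_mul] at key
  have hne : w ^ s ≠ 1 := fun h1 => absurd (Nat.le_of_dvd hs0 ((hprim.pow_eq_one_iff_dvd s).1 h1))
    (not_le.2 hs)
  have : (w ^ s - 1) * ∫ x, h x * rademacher m K x ^ s ∂(haar m) = 0 := by
    rw [sub_mul, key, one_mul, sub_self]
  exact (mul_eq_zero.1 this).resolve_left (sub_ne_zero.2 hne)

end Measure

/-! ### Measurability as dependence on finitely many coordinates; Fourier coefficients of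
martingales. -/

section Filtration

variable (m : ℕ → ℕ) [∀ k, NeZero (m k)]

theorem finite_range_interval (N : ℕ) : (Set.range (interval m N)).Finite := by
  refine (Set.finite_range (fun z : (∀ i : Fin N, ZMod (m i)) =>
    {y : Group m | ∀ i : Fin N, y i = z i})).subset ?_
  rintro _ ⟨y, rfl⟩
  refine ⟨fun i => y i, ?_⟩
  ext w
  exact ⟨fun h k hk => h ⟨k, hk⟩, fun h i => h i i.2⟩

/-- The generating intervals have this invariance, and complements and countable unions keep it. It
makes f^(N) a function of N coordinates everywhere, not just almost everywhere. -/
theorem mem_iff_of_measurableSet_filtration {N : ℕ} {S : Set (Group m)}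
    (hS : MeasurableSet[filtration m N] S) {x y : Group m} (hxy : ∀ k < N, x k = y k) :
    x ∈ S ↔ y ∈ S := by
  induction S, hS using MeasurableSpace.generateFrom_induction with
  | hC S hS _ =>
    obtain ⟨z, rfl⟩ := hS
    exact ⟨fun h k hk => (hxy k hk).symm.trans (h k hk), fun h k hk => (hxy k hk).trans (h k hk)⟩
  | empty => exact Iff.rfl
  | compl S _ ih => exact not_congr ih
  | iUnion s _ ih => simp only [Set.mem_iUnion, ih]

theorem dependsOn_of_stronglyMeasurable {N : ℕ} {f : Group m → ℂ}
    (hf : StronglyMeasurable[filtration m N] f) : DependsOn f (Set.Iio N) := by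
  intro x y hxy
  have := mem_iff_of_measurableSet_filtration m (hf.measurable (measurableSet_singleton (f x)))
    (x := x) (y := y) hxy
  exact (this.1 rfl).symm

theorem stronglyMeasurable_of_dependsOn {N : ℕ} {f : Group m → ℂ}
    (hf : DependsOn f (Set.Iio N)) : StronglyMeasurable[filtration m N] f := by
  refine Measurable.stronglyMeasurable fun S _ => ?_
  have hU : f ⁻¹' S = ⋃₀ (interval m N '' (f ⁻¹' S)) := by
    ext y
    constructor
    · intro hy
      exact ⟨_, ⟨y, hy, rfl⟩, mem_interval_self m N y⟩
    · rintro ⟨_, ⟨z, hz, rfl⟩, hy⟩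
      rw [Set.mem_preimage, hf hy]
      exact hz
  rw [hU]
  refine MeasurableSet.sUnion
    ((finite_range_interval m N).subset (Set.image_subset_range _ _)).countable ?_
  rintro _ ⟨z, _, rfl⟩
  exact MeasurableSpace.measurableSet_generateFrom ⟨z, rfl⟩

theorem measurable_of_dependsOn {N : ℕ} {f : Group m → ℂ}
    (hf : DependsOn f (Set.Iio N)) : Measurable f :=
  ((stronglyMeasurable_of_dependsOn m hf).mono ((filtration m).le N)).measurable

/-- For a martingale, pairing with a bounded function of the first `N` coordinates gives a
sequence that is constant from `N` on. -/
theorem integral_martingale_mul {f : ℕ → Group m → ℂ}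
    (hf : Martingale f (filtration m) (haar m)) {N j : ℕ} (hNj : N ≤ j) {g : Group m → ℂ}
    (hg : DependsOn g (Set.Iio N)) {C : ℝ} (hgC : ∀ x, ‖g x‖ ≤ C) :
    ∫ x, f j x * g x ∂(haar m) = ∫ x, f N x * g x ∂(haar m) := by
  have hint : Integrable (fun x => f j x * g x) (haar m) :=
    (hf.integrable j).mul_bdd (c := C) (measurable_of_dependsOn m hg).aestronglyMeasurable
      (Eventually.of_forall hgC)
  have h := condExp_bilin_of_stronglyMeasurable_right (ContinuousLinearMap.mul ℝ ℂ)
    (stronglyMeasurable_of_dependsOn m hg) hint (hf.integrable j)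
  simp only [ContinuousLinearMap.mul_apply'] at h
  rw [← integral_condExp ((filtration m).le N)]
  refine integral_congr_ae ?_
  filter_upwards [h, hf.2 N j hNj] with x hx hx'
  rw [hx, hx']

theorem fourierCoeff_eq (hm : ∀ k, 2 ≤ m k) {f : ℕ → Group m → ℂ}
    (hf : Martingale f (filtration m) (haar m)) {i N : ℕ} (hi : i < bigM m N) :
    fourierCoeff m f i = ∫ x, f N x * conj (psi m i x) ∂(haar m) := by
  refine Tendsto.limUnder_eq (tendsto_const_nhds.congr' ?_)
  filter_upwards [eventually_ge_atTop N] with j hj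
  refine (integral_martingale_mul m hf hj (g := fun x => conj (psi m i x)) (C := 1) ?_ ?_).symm
  · intro x y hxy
    simp only
    rw [dependsOn_psi m hm hi hxy]
  · intro x
    rw [RCLike.norm_conj, norm_psi]

theorem partialSum_eq_integral (hm : ∀ k, 2 ≤ m k) {f : ℕ → Group m → ℂ}
    (hf : Martingale f (filtration m) (haar m)) {n N : ℕ} (hn : n ≤ bigM m N) (x : Group m) :
    partialSum m f n x = ∫ t, f N t * dirichletKernel m n x t ∂(haar m) := by
  simp only [dirichletKernel, Finset.mul_sum]
  rw [integral_finsetSum]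
  · refine Finset.sum_congr rfl fun k hk => ?_
    rw [fourierCoeff_eq m hm hf ((Finset.mem_range.1 hk).trans_le hn), mul_comm,
      ← integral_const_mul]
    congr 1; ext t; ring
  · intro k _
    refine (hf.integrable N).mul_bdd (c := 1) ?_ (Eventually.of_forall fun t => ?_)
    · exact ((Complex.continuous_conj.measurable.comp
        (measurable_psi m k)).const_mul _).aestronglyMeasurable
    · rw [norm_mul, RCLike.norm_conj, norm_psi, norm_psi, one_mul]

end Filtration

/-! ### Logarithmic means as averages. -/

section LogMeans

variable (m : ℕ → ℕ) [∀ k, NeZero (m k)]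

/-- For n ≥ 2 the quotient is a convex combination of the a_k, as k ↦ n - k matches the weights with
the denominator. -/
theorem norm_logWeights_le {n : ℕ} {a : ℕ → ℂ} {R : ℝ} (hR : 0 ≤ R)
    (h : ∀ k ∈ Finset.Ico 1 n, ‖a k‖ ≤ R) :
    ‖(∑ k ∈ Finset.Ico 1 n, a k / ((n : ℂ) - (k : ℂ))) /
      ∑ k ∈ Finset.Ico 1 n, (1 : ℂ) / (k : ℂ)‖ ≤ R := by
  have hden : (∑ k ∈ Finset.Ico 1 n, (1 : ℂ) / (k : ℂ)) =
      ((∑ k ∈ Finset.Ico 1 n, (1 : ℝ) / k : ℝ) : ℂ) := by push_cast; rfl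
  have hnn : 0 ≤ ∑ k ∈ Finset.Ico 1 n, (1 : ℝ) / k := Finset.sum_nonneg fun _ _ => by positivity
  rw [hden, norm_div, Complex.norm_real, Real.norm_of_nonneg hnn]
  -- For n ≤ 1 the denominator is 0 and the quotient is 0 by convention, which this inequality
  -- allows.
  refine div_le_of_le_mul₀ hnn hR ((norm_sum_le _ _).trans ?_)
  have hrefl : ∑ k ∈ Finset.Ico 1 n, (1 : ℝ) / k = ∑ k ∈ Finset.Ico 1 n, 1 / ((n : ℝ) - k) := by
    refine Finset.sum_bij' (fun k _ => n - k) (fun k _ => n - k) ?_ ?_ ?_ ?_ ?_ <;>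
      intro k hk <;> rw [Finset.mem_Ico] at hk
    · rw [Finset.mem_Ico]; omega
    · rw [Finset.mem_Ico]; omega
    · omega
    · omega
    · rw [Nat.cast_sub hk.2.le]; ring
  rw [hrefl, Finset.mul_sum]
  refine Finset.sum_le_sum fun k hk => ?_
  have hk' := Finset.mem_Ico.1 hk
  have hpos : (0 : ℝ) < (n : ℝ) - k := sub_pos.2 (Nat.cast_lt.2 hk'.2)
  have : ((n : ℂ) - (k : ℂ)) = (((n : ℝ) - k : ℝ) : ℂ) := by push_cast; rfl
  rw [norm_div, this, Complex.norm_real, Real.norm_of_nonneg hpos.le, mul_one_div]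
  exact div_le_div_of_nonneg_right (h k hk) hpos.le

theorem enorm_norlundLogMean_le {f : ℕ → Group m → ℂ} {n : ℕ} {x : Group m} {R : ℝ≥0∞}
    (h : ∀ k < n, ‖partialSum m f k x‖ₑ ≤ R) : ‖norlundLogMean m f n x‖ₑ ≤ R := by
  induction R with
  | top => exact le_top
  | coe R =>
    have := norm_logWeights_le (n := n) (a := fun k => partialSum m f k x) R.2 fun k hk => by
      have := h k (Finset.mem_Ico.1 hk).2
      rwa [enorm_le_coe] at this
    exact enorm_le_coe.2 this

end LogMeans

/-! ### Subadditivity of the p-th power. -/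

section QuasiNorm

/-- Replaces the triangle inequality of L_p, in the bound for the majorant and in the proof that the
lacunary martingale is in H_p. -/
theorem tsum_rpow_le {a : ℕ → ℝ≥0∞} {p : ℝ} (hp0 : 0 < p) (hp1 : p ≤ 1) :
    (∑' j, a j) ^ p ≤ ∑' j, a j ^ p := by
  rw [← ENNReal.le_rpow_inv_iff hp0, ENNReal.tsum_eq_iSup_sum]
  refine iSup_le fun s => ?_
  rw [ENNReal.le_rpow_inv_iff hp0]
  refine le_trans ?_ (ENNReal.sum_le_tsum s)
  exact Finset.le_sum_of_subadditive (fun x : ℝ≥0∞ => x ^ p) (ENNReal.zero_rpow_of_pos hp0).le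
    (fun x y => ENNReal.rpow_add_le_add_rpow x y hp0.le hp1) s a

theorem eLpNorm_ofReal_eq {α : Type*} [MeasurableSpace α] (μ : Measure α) {p : ℝ} (hp0 : 0 < p)
    (g : α → ℝ≥0∞) :
    eLpNorm g (ENNReal.ofReal p) μ = (∫⁻ x, g x ^ p ∂μ) ^ (1 / p) := by
  rw [eLpNorm_eq_lintegral_rpow_enorm_toReal (by simpa using hp0) ENNReal.ofReal_ne_top,
    ENNReal.toReal_ofReal hp0.le]
  simp

end QuasiNorm

/-! ### Part a): a majorant independent of n. -/

section Majorant

theorem tsum_bigM_rpow_lt_top (m : ℕ → ℕ) (hm : ∀ k, 2 ≤ m k) {p : ℝ} (hp1 : p < 1) :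
    ∑' j, (bigM m j : ℝ≥0∞) ^ (p - 1) < ∞ := by
  have hr : (2 : ℝ≥0∞) ^ (p - 1) < 1 :=
    ENNReal.rpow_lt_one_of_one_lt_of_neg ENNReal.one_lt_two (by linarith)
  have hle : ∀ j, (bigM m j : ℝ≥0∞) ^ (p - 1) ≤ ((2 : ℝ≥0∞) ^ (p - 1)) ^ j := by
    intro j
    rw [← ENNReal.rpow_natCast, ← ENNReal.rpow_mul, mul_comm, ENNReal.rpow_mul,
      ENNReal.rpow_natCast]
    rw [← neg_sub 1 p, ENNReal.rpow_neg, ENNReal.rpow_neg, ENNReal.inv_le_inv]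
    refine ENNReal.rpow_le_rpow ?_ (by linarith)
    exact_mod_cast two_pow_le_bigM m hm j
  refine (ENNReal.tsum_le_tsum hle).trans_lt ?_
  rw [ENNReal.tsum_geometric, ENNReal.inv_lt_top]
  exact tsub_pos_of_lt hr

/-- The least admissible N works, since M_{N-1} < n; the summand 1 covers n = 0. -/
theorem exists_bigM_between (m : ℕ → ℕ) {B : ℕ} (hm : ∀ k, 2 ≤ m k) (hB : ∀ k, m k ≤ B) (n : ℕ) :
    ∃ N, n ≤ bigM m N ∧ bigM m N ≤ B * (n + 1) := by
  have hex : ∃ N, n ≤ bigM m N := ⟨n, (lt_bigM m hm n).le⟩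
  refine ⟨Nat.find hex, Nat.find_spec hex, ?_⟩
  rcases hN : Nat.find hex with _ | k
  · have : 1 ≤ B := (one_le_two.trans (hm 0)).trans (hB 0)
    exact Nat.mul_pos this n.succ_pos
  · have := Nat.find_min hex (m := k) (by omega)
    exact Nat.mul_le_mul (hB k) (by omega)

variable (m : ℕ → ℕ) [∀ k, NeZero (m k)]

theorem measurable_maximalFunction {f : ℕ → Group m → ℂ}
    (hf : Martingale f (filtration m) (haar m)) : Measurable (maximalFunction m f) :=
  Measurable.iSup fun n => ((hf.1 n).mono ((filtration m).le n)).measurable.enorm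

/-- On functions of the first `N` coordinates, the `L_1` quasi-norm is controlled by the `L_p`
quasi-norm, at the cost of a power of `M_N`. -/
theorem setLIntegral_interval_le {p : ℝ} (hp0 : 0 < p) (hp1 : p < 1) {j N : ℕ} (hj : j ≤ N)
    {h : Group m → ℝ≥0∞} (hmeas : Measurable h) (hh : DependsOn h (Set.Iio N)) (x : Group m) :
    ∫⁻ t in interval m j x, h t ∂(haar m) ≤
      (bigM m N : ℝ≥0∞) ^ (1 / p - 1) *
        (∫⁻ t in interval m j x, h t ^ p ∂(haar m)) ^ (1 / p) := by
  set Q := ∫⁻ t in interval m j x, h t ^ p ∂(haar m) with hQ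
  have hq : 0 ≤ 1 / p - 1 := by
    rw [sub_nonneg, le_div_iff₀ hp0]; linarith
  -- h is constant on I_N(t) ⊆ I_j(x), of measure 1 / M_N. This sup bound then controls the factor
  -- (h^p)^(1/p-1) in h = h^p (h^p)^(1/p-1).
  have hsup : ∀ t ∈ interval m j x, h t ^ p ≤ bigM m N * Q := by
    intro t ht
    calc h t ^ p = h t ^ p * (bigM m N * haar m (interval m N t)) := by
          rw [bigM_mul_haar_interval, mul_one]
      _ = bigM m N * ∫⁻ _ in interval m N t, h t ^ p ∂(haar m) := by
          rw [setLIntegral_const]; ring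
      _ = bigM m N * ∫⁻ s in interval m N t, h s ^ p ∂(haar m) := by
          congr 1
          refine setLIntegral_congr_fun (measurableSet_interval N t) fun s hs => ?_
          simp only [hh (x := t) (y := s) fun k hk => (hs k hk).symm]
      _ ≤ bigM m N * Q := by
          refine mul_le_mul_right (lintegral_mono_set ?_) _
          rw [← interval_eq_of_mem m ht]
          exact interval_anti m t hj
  calc ∫⁻ t in interval m j x, h t ∂(haar m)
      ≤ ∫⁻ t in interval m j x, h t ^ p * (bigM m N * Q) ^ (1 / p - 1) ∂(haar m) := by
        refine setLIntegral_mono' (measurableSet_interval j x) fun t ht => ?_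
        calc h t = h t ^ (p + p * (1 / p - 1)) := by
              rw [show p + p * (1 / p - 1) = 1 by field_simp; ring, ENNReal.rpow_one]
          _ = h t ^ p * (h t ^ p) ^ (1 / p - 1) := by
              rw [ENNReal.rpow_add_of_nonneg _ _ hp0.le (mul_nonneg hp0.le hq), ENNReal.rpow_mul]
          _ ≤ h t ^ p * (bigM m N * Q) ^ (1 / p - 1) := by
              gcongr
              exact hsup t ht
    _ = Q * (bigM m N * Q) ^ (1 / p - 1) := lintegral_mul_const _ (hmeas.pow_const p)
    _ = (bigM m N : ℝ≥0∞) ^ (1 / p - 1) * Q ^ (1 / p) := by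
        rw [ENNReal.mul_rpow_of_nonneg _ _ hq, mul_left_comm]
        congr 1
        nth_rewrite 1 [← ENNReal.rpow_one Q]
        rw [← ENNReal.rpow_add_of_nonneg _ _ zero_le_one hq]
        congr 1; ring

/-- A majorant of the weighted partial sums of `f`. -/
noncomputable def majorant (p : ℝ) (f : ℕ → Group m → ℂ) (x : Group m) : ℝ≥0∞ :=
  ∑' j, (bigM m j : ℝ≥0∞) *
    (∫⁻ t in interval m j x, maximalFunction m f t ^ p ∂(haar m)) ^ (1 / p)

/-- One factor B comes from the kernel bound, and B^(1/p-1) from M_N ≤ B(n+1). -/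
theorem enorm_partialSum_le {B : ℕ} (hm : ∀ k, 2 ≤ m k) (hB : ∀ k, m k ≤ B) {p : ℝ}
    (hp0 : 0 < p) (hp1 : p < 1) {f : ℕ → Group m → ℂ}
    (hf : Martingale f (filtration m) (haar m)) (n : ℕ) (x : Group m) :
    ‖partialSum m f n x‖ₑ ≤
      (B : ℝ≥0∞) ^ (1 / p) * majorant m p f x * ENNReal.ofReal (((n : ℝ) + 1) ^ (1 / p - 1)) := by
  classical
  have hq : 0 ≤ 1 / p - 1 := by
    rw [sub_nonneg, le_div_iff₀ hp0]; linarith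
  obtain ⟨N, hnN, hNB⟩ := exists_bigM_between m hm hB n
  have hmeas : Measurable (f N) := ((hf.1 N).mono ((filtration m).le N)).measurable
  have hker : ∀ t, ‖dirichletKernel m n x t‖ₑ ≤
      B * ∑ j ∈ Finset.range (N + 1), (interval m j x).indicator (fun _ => (bigM m j : ℝ≥0∞)) t := by
    intro t
    have h := norm_dirichletKernel_le_sum m hm hB hnN x t
    rw [← ofReal_norm]
    refine (ENNReal.ofReal_le_ofReal h).trans_eq ?_
    rw [ENNReal.ofReal_mul (Nat.cast_nonneg _), ENNReal.ofReal_natCast, ENNReal.ofReal_sum_of_nonneg]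
    · congr 1
      refine Finset.sum_congr rfl fun j _ => ?_
      by_cases ht : t ∈ interval m j x <;> simp [ht]
    · intro j _
      split_ifs <;> positivity
  have hle : ∀ t, ‖f N t‖ₑ ≤ maximalFunction m f t := fun t => le_iSup (fun n => ‖f n t‖ₑ) N
  have hdep : DependsOn (fun t => ‖f N t‖ₑ) (Set.Iio N) := fun s t hst => by
    simp only [dependsOn_of_stronglyMeasurable m (hf.1 N) hst]
  calc ‖partialSum m f n x‖ₑ
      ≤ ∫⁻ t, ‖f N t‖ₑ * ‖dirichletKernel m n x t‖ₑ ∂(haar m) := by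
        rw [partialSum_eq_integral m hm hf hnN]
        refine (enorm_integral_le_lintegral_enorm _).trans_eq ?_
        simp only [enorm_mul]
    _ ≤ ∫⁻ t, B * ∑ j ∈ Finset.range (N + 1), (interval m j x).indicator
          (fun t => (bigM m j : ℝ≥0∞) * ‖f N t‖ₑ) t ∂(haar m) := by
        refine lintegral_mono fun t => (mul_le_mul_right (hker t) _).trans_eq ?_
        rw [mul_left_comm, Finset.mul_sum]
        congr 1
        refine Finset.sum_congr rfl fun j _ => ?_
        by_cases ht : t ∈ interval m j x <;> simp [ht, mul_comm]
    _ = B * ∑ j ∈ Finset.range (N + 1),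
          (bigM m j : ℝ≥0∞) * ∫⁻ t in interval m j x, ‖f N t‖ₑ ∂(haar m) := by
        have hm1 : ∀ j, Measurable ((interval m j x).indicator
            (fun t => (bigM m j : ℝ≥0∞) * ‖f N t‖ₑ)) := fun j =>
          (hmeas.enorm.const_mul _).indicator (measurableSet_interval j x)
        rw [lintegral_const_mul _ (Finset.measurable_fun_sum _ fun j _ => hm1 j),
          lintegral_finsetSum _ fun j _ => hm1 j]
        congr 1
        refine Finset.sum_congr rfl fun j _ => ?_
        rw [lintegral_indicator (measurableSet_interval j x), lintegral_const_mul _ hmeas.enorm]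
    _ ≤ B * ∑ j ∈ Finset.range (N + 1), (bigM m N : ℝ≥0∞) ^ (1 / p - 1) *
          ((bigM m j : ℝ≥0∞) *
            (∫⁻ t in interval m j x, maximalFunction m f t ^ p ∂(haar m)) ^ (1 / p)) := by
        refine mul_le_mul_right (Finset.sum_le_sum fun j hj => ?_) _
        rw [mul_left_comm]
        refine mul_le_mul_right ((setLIntegral_interval_le m hp0 hp1
          (Nat.lt_succ_iff.1 (Finset.mem_range.1 hj)) hmeas.enorm hdep x).trans ?_) _
        gcongr with t
        exact hle t
    _ ≤ B * ((bigM m N : ℝ≥0∞) ^ (1 / p - 1) * majorant m p f x) := by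
        rw [← Finset.mul_sum]
        gcongr
        exact ENNReal.sum_le_tsum _
    _ ≤ B * ((B * ENNReal.ofReal ((n : ℝ) + 1)) ^ (1 / p - 1) * majorant m p f x) := by
        gcongr
        have : ENNReal.ofReal ((n : ℝ) + 1) = ((n + 1 : ℕ) : ℝ≥0∞) := by
          rw [← ENNReal.ofReal_natCast]; push_cast; rfl
        rw [this]
        exact_mod_cast hNB
    _ = _ := by
        have hB1 : (B : ℝ≥0∞) ^ (1 / p) = B * (B : ℝ≥0∞) ^ (1 / p - 1) := by
          nth_rewrite 2 [← ENNReal.rpow_one (B : ℝ≥0∞)]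
          rw [← ENNReal.rpow_add_of_nonneg _ _ zero_le_one hq]
          congr 1; ring
        rw [ENNReal.mul_rpow_of_nonneg _ _ hq, ENNReal.ofReal_rpow_of_pos (by positivity), hB1]
        ring

/-- Tonelli, with the symmetry of t ∈ I_j(x) in x and t. -/
theorem lintegral_setLIntegral_interval (j : ℕ) {G : Group m → ℝ≥0∞} (hG : Measurable G) :
    ∫⁻ x, ∫⁻ t in interval m j x, G t ∂(haar m) ∂(haar m) =
      (bigM m j : ℝ≥0∞)⁻¹ * ∫⁻ t, G t ∂(haar m) := by
  have hmeas : Measurable fun z : Group m × Group m =>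
      {z : Group m × Group m | z.2 ∈ interval m j z.1}.indicator (fun z => G z.2) z :=
    (hG.comp measurable_snd).indicator (measurableSet_mem_interval m j)
  calc ∫⁻ x, ∫⁻ t in interval m j x, G t ∂(haar m) ∂(haar m)
      = ∫⁻ x, ∫⁻ t, {z : Group m × Group m | z.2 ∈ interval m j z.1}.indicator
          (fun z => G z.2) (x, t) ∂(haar m) ∂(haar m) := by
        refine lintegral_congr fun x => ?_
        rw [← lintegral_indicator (measurableSet_interval j x)]
        rfl
    _ = ∫⁻ t, ∫⁻ x, {z : Group m × Group m | z.2 ∈ interval m j z.1}.indicator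
          (fun z => G z.2) (x, t) ∂(haar m) ∂(haar m) := lintegral_lintegral_swap hmeas.aemeasurable
    _ = ∫⁻ t, (bigM m j : ℝ≥0∞)⁻¹ * G t ∂(haar m) := by
        refine lintegral_congr fun t => ?_
        rw [← haar_interval m j t, mul_comm, ← setLIntegral_const,
          ← lintegral_indicator (measurableSet_interval j t)]
        refine lintegral_congr fun x => ?_
        by_cases hx : x ∈ interval m j t
        · rw [Set.indicator_of_mem hx,
            Set.indicator_of_mem (show (x, t) ∈ {z : Group m × Group m | z.2 ∈ interval m j z.1}
              from (mem_interval_comm m).1 hx)]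
        · rw [Set.indicator_of_notMem hx,
            Set.indicator_of_notMem (show (x, t) ∉ {z : Group m × Group m | z.2 ∈ interval m j z.1}
              from fun h => hx ((mem_interval_comm m).1 h))]
    _ = _ := lintegral_const_mul _ hG

theorem measurable_setLIntegral_interval (j : ℕ) {G : Group m → ℝ≥0∞} (hG : Measurable G) :
    Measurable fun x => ∫⁻ t in interval m j x, G t ∂(haar m) := by
  have hmeas : Measurable fun z : Group m × Group m =>
      {z : Group m × Group m | z.2 ∈ interval m j z.1}.indicator (fun z => G z.2) z :=
    (hG.comp measurable_snd).indicator (measurableSet_mem_interval m j)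
  convert hmeas.lintegral_prod_right' (ν := haar m) using 2 with x
  rw [← lintegral_indicator (measurableSet_interval j x)]
  rfl

/-- Moving the p-th power inside the sum cancels the exponent 1/p and leaves M_j^p; averaging over x
contributes M_j^(-1). -/
theorem lintegral_majorant_rpow_le {p : ℝ} (hp0 : 0 < p) (hp1 : p < 1) {f : ℕ → Group m → ℂ}
    (hf : Martingale f (filtration m) (haar m)) :
    ∫⁻ x, majorant m p f x ^ p ∂(haar m) ≤
      (∑' j, (bigM m j : ℝ≥0∞) ^ (p - 1)) * ∫⁻ x, maximalFunction m f x ^ p ∂(haar m) := by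
  have hF : Measurable fun x => maximalFunction m f x ^ p :=
    (measurable_maximalFunction m hf).pow_const p
  calc ∫⁻ x, majorant m p f x ^ p ∂(haar m)
      ≤ ∫⁻ x, ∑' j, (bigM m j : ℝ≥0∞) ^ p *
          ∫⁻ t in interval m j x, maximalFunction m f t ^ p ∂(haar m) ∂(haar m) := by
        refine lintegral_mono fun x => (tsum_rpow_le hp0 hp1.le).trans_eq ?_
        refine tsum_congr fun j => ?_
        rw [ENNReal.mul_rpow_of_nonneg _ _ hp0.le, ← ENNReal.rpow_mul, one_div_mul_cancel hp0.ne',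
          ENNReal.rpow_one]
    _ = ∑' j, (bigM m j : ℝ≥0∞) ^ p * ((bigM m j : ℝ≥0∞)⁻¹ *
          ∫⁻ t, maximalFunction m f t ^ p ∂(haar m)) := by
        rw [lintegral_tsum fun j =>
          ((measurable_setLIntegral_interval m j hF).const_mul _).aemeasurable]
        refine tsum_congr fun j => ?_
        rw [lintegral_const_mul _ (measurable_setLIntegral_interval m j hF),
          lintegral_setLIntegral_interval m j hF]
    _ = _ := by
        rw [← ENNReal.tsum_mul_right]
        refine tsum_congr fun j => ?_
        rw [← mul_assoc, ENNReal.rpow_sub _ _ (Nat.cast_ne_zero.2 (bigM_pos m j).ne')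
          (ENNReal.natCast_ne_top _), ENNReal.rpow_one, div_eq_mul_inv]

theorem weightedMax_le_majorant {B : ℕ} (hm : ∀ k, 2 ≤ m k) (hB : ∀ k, m k ≤ B) {p : ℝ}
    (hp0 : 0 < p) (hp1 : p < 1) {f : ℕ → Group m → ℂ}
    (hf : Martingale f (filtration m) (haar m)) (x : Group m) :
    weightedMax m (fun n => ((n : ℝ) + 1) ^ (1 / p - 1)) f x ≤
      (B : ℝ≥0∞) ^ (1 / p) * majorant m p f x := by
  have hq : 0 ≤ 1 / p - 1 := by
    rw [sub_nonneg, le_div_iff₀ hp0]; linarith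
  refine iSup_le fun n => ENNReal.div_le_of_le_mul (enorm_norlundLogMean_le m fun k hk => ?_)
  refine (enorm_partialSum_le m hm hB hp0 hp1 hf k x).trans ?_
  simp only
  gcongr

theorem boundedHardyLp_weightedMax (hm : ∀ k, 2 ≤ m k) (hbdd : BddAbove (Set.range m)) {p : ℝ}
    (hp0 : 0 < p) (hp1 : p < 1) :
    BoundedHardyLp m p (weightedMax m fun n => ((n : ℝ) + 1) ^ (1 / p - 1)) := by
  obtain ⟨B, hB⟩ := hbdd
  replace hB : ∀ k, m k ≤ B := fun k => hB ⟨k, rfl⟩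
  set K : ℝ≥0∞ := (B : ℝ≥0∞) ^ (1 / p) with hK
  set R : ℝ≥0∞ := (∑' j, (bigM m j : ℝ≥0∞) ^ (p - 1)) ^ (1 / p) with hR
  have hKt : K ≠ ∞ := ENNReal.rpow_ne_top_of_nonneg (by positivity) (ENNReal.natCast_ne_top _)
  have hRt : R ≠ ∞ :=
    ENNReal.rpow_ne_top_of_nonneg (by positivity) (tsum_bigM_rpow_lt_top m hm hp1).ne
  refine ⟨(K * R).toNNReal, fun f hf => ?_⟩
  rw [ENNReal.coe_toNNReal (ENNReal.mul_ne_top hKt hRt), hardyNorm, eLpNorm_ofReal_eq _ hp0,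
    eLpNorm_ofReal_eq _ hp0]
  calc _ ≤ (∫⁻ x, (K * majorant m p f x) ^ p ∂(haar m)) ^ (1 / p) := by
        gcongr with x
        exact weightedMax_le_majorant m hm hB hp0 hp1 hf.1 x
    _ = (K ^ p * ∫⁻ x, majorant m p f x ^ p ∂(haar m)) ^ (1 / p) := by
        -- The constant is finite, so measurability of the majorant is not needed.
        rw [← lintegral_const_mul' _ _ (ENNReal.rpow_ne_top_of_nonneg hp0.le hKt)]
        simp only [ENNReal.mul_rpow_of_nonneg _ _ hp0.le]
    _ ≤ (K ^ p * ((∑' j, (bigM m j : ℝ≥0∞) ^ (p - 1)) *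
          ∫⁻ x, maximalFunction m f x ^ p ∂(haar m))) ^ (1 / p) := by
        gcongr
        exact lintegral_majorant_rpow_le m hp0 hp1 hf.1
    _ = _ := by
        have h0 : 0 ≤ 1 / p := by positivity
        rw [ENNReal.mul_rpow_of_nonneg _ _ h0, ENNReal.mul_rpow_of_nonneg _ _ h0,
          ← ENNReal.rpow_mul, mul_one_div_cancel hp0.ne', ENNReal.rpow_one, mul_assoc]

end Majorant

/-! ### Martingales with Rademacher differences. -/

section Lacunary

variable (m : ℕ → ℕ)

/-- The difference of order `a`: the function `M_a r_a` on the interval `I_a(0)`. -/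
noncomputable def rademacherDiff (a : ℕ) (x : Group m) : ℂ :=
  (interval m a 0).indicator (fun _ => (bigM m a : ℂ)) x * rademacher m a x

/-- The martingale with differences `c_a M_a 1_{I_a(0)} r_a`. -/
noncomputable def rademacherMartingale (c : ℕ → ℝ) (n : ℕ) (x : Group m) : ℂ :=
  ∑ a ∈ Finset.range n, (c a : ℂ) * rademacherDiff m a x

theorem dependsOn_indicator_interval (a : ℕ) (z : ℂ) :
    DependsOn ((interval m a 0).indicator (fun _ => z)) (Set.Iio a) := by
  intro x y hxy
  have : x ∈ interval m a 0 ↔ y ∈ interval m a 0 :=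
    ⟨fun h k hk => (hxy k hk).symm.trans (h k hk), fun h k hk => (hxy k hk).trans (h k hk)⟩
  by_cases hx : x ∈ interval m a 0
  · rw [Set.indicator_of_mem hx, Set.indicator_of_mem (this.1 hx)]
  · rw [Set.indicator_of_notMem hx, Set.indicator_of_notMem (mt this.2 hx)]

theorem norm_rademacherDiff (a : ℕ) (x : Group m) :
    ‖rademacherDiff m a x‖ = (interval m a 0).indicator (fun _ => (bigM m a : ℝ)) x := by
  rw [rademacherDiff, norm_mul, norm_rademacher, mul_one]
  by_cases hx : x ∈ interval m a 0 <;> simp [hx]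

theorem enorm_rademacherDiff (a : ℕ) (x : Group m) :
    ‖rademacherDiff m a x‖ₑ = (interval m a 0).indicator (fun _ => (bigM m a : ℝ≥0∞)) x := by
  rw [← ofReal_norm, norm_rademacherDiff]
  by_cases hx : x ∈ interval m a 0 <;> simp [hx]

theorem norm_rademacherDiff_le (a : ℕ) (x : Group m) : ‖rademacherDiff m a x‖ ≤ bigM m a := by
  rw [norm_rademacherDiff]
  exact Set.indicator_le_self' (fun _ _ => by positivity) x

theorem norm_rademacherMartingale_le {c : ℕ → ℝ} (hc : ∀ a, 0 ≤ c a) (n : ℕ) (x : Group m) :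
    ‖rademacherMartingale m c n x‖ ≤ ∑ a ∈ Finset.range n, c a * bigM m a := by
  refine (norm_sum_le _ _).trans (Finset.sum_le_sum fun a _ => ?_)
  rw [norm_mul, Complex.norm_real, Real.norm_of_nonneg (hc a)]
  exact mul_le_mul_of_nonneg_left (norm_rademacherDiff_le m a x) (hc a)

theorem rademacherMartingale_succ (c : ℕ → ℝ) (n : ℕ) (x : Group m) :
    rademacherMartingale m c (n + 1) x =
      rademacherMartingale m c n x + c n * rademacherDiff m n x :=
  Finset.sum_range_succ _ _

variable [∀ k, NeZero (m k)]

theorem dependsOn_rademacherDiff (a : ℕ) :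
    DependsOn (rademacherDiff m a) (Set.Iio (a + 1)) := by
  intro x y hxy
  rw [rademacherDiff, rademacherDiff, (rademacher_eq_iff m a x y).2 (hxy a (Nat.lt_succ_self a)),
    dependsOn_indicator_interval m a _ fun k hk => hxy k (Nat.lt_succ_of_lt hk)]

theorem dependsOn_rademacherMartingale (c : ℕ → ℝ) (n : ℕ) :
    DependsOn (rademacherMartingale m c n) (Set.Iio n) := by
  intro x y hxy
  refine Finset.sum_congr rfl fun a ha => ?_
  rw [dependsOn_rademacherDiff m a fun k hk => hxy k
    (lt_of_lt_of_le hk (Nat.succ_le_of_lt (Finset.mem_range.1 ha)))]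

theorem integrable_of_dependsOn {N : ℕ} {f : Group m → ℂ} (hf : DependsOn f (Set.Iio N)) {C : ℝ}
    (hC : ∀ x, ‖f x‖ ≤ C) : Integrable f (haar m) :=
  Integrable.of_bound (measurable_of_dependsOn m hf).aestronglyMeasurable C
    (Eventually.of_forall hC)

theorem integrable_rademacherDiff (a : ℕ) : Integrable (rademacherDiff m a) (haar m) :=
  integrable_of_dependsOn m (dependsOn_rademacherDiff m a) (norm_rademacherDiff_le m a)

theorem integrable_rademacherMartingale (c : ℕ → ℝ) (n : ℕ) :
    Integrable (rademacherMartingale m c n) (haar m) :=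
  integrable_finsetSum _ fun a _ => (integrable_rademacherDiff m a).const_mul _

/-- On a set of F_n, the n-th difference is r_n times a function of the first n coordinates, so its
integral vanishes. -/
theorem martingale_rademacherMartingale (hm : ∀ k, 2 ≤ m k) (c : ℕ → ℝ) :
    Martingale (rademacherMartingale m c) (filtration m) (haar m) := by
  refine martingale_of_setIntegral_eq_succ
    (fun n => stronglyMeasurable_of_dependsOn m (dependsOn_rademacherMartingale m c n))
    (integrable_rademacherMartingale m c) fun n s hs => ?_
  have hzero : ∫ x in s, rademacherDiff m n x ∂(haar m) = 0 := by
    rw [← integral_indicator ((filtration m).le n s hs)]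
    have hdep : DependsOn (s.indicator ((interval m n 0).indicator
        (fun _ => (bigM m n : ℂ)))) (Set.Iio n) := by
      intro x y hxy
      have := mem_iff_of_measurableSet_filtration m hs (x := x) (y := y) hxy
      by_cases hx : x ∈ s
      · rw [Set.indicator_of_mem hx, Set.indicator_of_mem (this.1 hx),
          dependsOn_indicator_interval m n _ hxy]
      · rw [Set.indicator_of_notMem hx, Set.indicator_of_notMem (mt this.2 hx)]
    rw [← integral_mul_rademacher_pow m one_pos (hm n) hdep]
    refine integral_congr_ae (Eventually.of_forall fun x => ?_)
    by_cases hx : x ∈ s <;> simp [hx, rademacherDiff]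
  simp only [rademacherMartingale_succ]
  rw [integral_add (integrable_rademacherMartingale m c n).integrableOn
    ((integrable_rademacherDiff m n).const_mul _).integrableOn, integral_const_mul, hzero,
    mul_zero, add_zero]

/-- The leading digit s of i sits at a position K ≥ b. There conj r_K^s = r_K^(m_K - s) is a
nontrivial power, and the other factors depend only on coordinates below K. -/
theorem integral_mul_conj_psi_eq_zero (hm : ∀ k, 2 ≤ m k) {b i : ℕ} (hi : bigM m b ≤ i)
    {g : Group m → ℂ} (hg : DependsOn g (Set.Iio b)) :
    ∫ x, g x * conj (psi m i x) ∂(haar m) = 0 := by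
  have hex : ∃ N, i < bigM m N := ⟨i, lt_bigM m hm i⟩
  obtain ⟨K, hK⟩ : ∃ K, Nat.find hex = K + 1 := by
    refine Nat.exists_eq_succ_of_ne_zero fun h0 => ?_
    have := Nat.find_spec hex
    rw [h0] at this
    exact absurd (hi.trans_lt this) (not_lt.2 (bigM_mono m (Nat.zero_le b)))
  have hlt : i < m K * bigM m K := by
    have := Nat.find_spec hex
    rwa [hK] at this
  have hge : bigM m K ≤ i := not_lt.1 (Nat.find_min hex (by omega))
  have hbK : b ≤ K := by
    by_contra h
    exact absurd (hlt.trans_le (bigM_mono m (Nat.succ_le_of_lt (not_le.1 h)))) (not_lt.2 hi)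
  set s := i / bigM m K with hs
  have hs1 : s < m K := (Nat.div_lt_iff_lt_mul (bigM_pos m K)).2 hlt
  have hs0 : 0 < s := Nat.div_pos hge (bigM_pos m K)
  have hmod : i % bigM m K < bigM m K := Nat.mod_lt _ (bigM_pos m K)
  have hpsi : ∀ x, conj (psi m i x) =
      conj (psi m (i % bigM m K) x) * rademacher m K x ^ (m K - s) := by
    intro x
    rw [← Nat.div_add_mod' i (bigM m K), psi_add m hm _ hmod, psi_mul_bigM m hm hs1, map_mul,
      map_pow, conj_rademacher, mul_comm, Nat.div_add_mod']
    congr 1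
    rw [inv_pow, inv_eq_iff_eq_inv, eq_comm, inv_eq_iff_eq_inv, ← one_div,
      eq_div_iff (pow_ne_zero _ (rademacher_ne_zero m K x)), ← pow_add, Nat.sub_add_cancel hs1.le,
      rademacher_pow_self]
  simp only [hpsi, ← mul_assoc]
  refine integral_mul_rademacher_pow m (by omega) (by omega) fun x y hxy => ?_
  rw [hg fun k hk => hxy k (lt_of_lt_of_le hk hbK), dependsOn_psi m hm hmod hxy]

/-- Earlier differences are orthogonal to ψ_{M_a} = r_a; the one of order a gives c_a M_a μ(I_a(0)).
-/
theorem fourierCoeff_rademacherMartingale_bigM (hm : ∀ k, 2 ≤ m k) (c : ℕ → ℝ) (a : ℕ) :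
    fourierCoeff m (rademacherMartingale m c) (bigM m a) = c a := by
  have hlt : bigM m a < bigM m (a + 1) := by
    have := Nat.mul_le_mul_right (bigM m a) (hm a)
    have := bigM_pos m a
    rw [bigM]; omega
  rw [fourierCoeff_eq m hm (martingale_rademacherMartingale m hm c) hlt]
  have hsplit : ∀ x, rademacherMartingale m c (a + 1) x * conj (psi m (bigM m a) x) =
      rademacherMartingale m c a x * conj (psi m (bigM m a) x) +
        c a * (interval m a 0).indicator (fun _ => (bigM m a : ℂ)) x := by
    intro x
    rw [rademacherMartingale_succ, add_mul, mul_assoc, rademacherDiff, psi_bigM m hm,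
      conj_rademacher, mul_inv_cancel_right₀ (rademacher_ne_zero m a x)]
  simp only [hsplit]
  rw [integral_add, integral_mul_conj_psi_eq_zero m hm le_rfl
    (dependsOn_rademacherMartingale m c a), zero_add, integral_const_mul,
    integral_indicator_const _ (measurableSet_interval a 0)]
  · have : (haar m).real (interval m a 0) = (bigM m a : ℝ)⁻¹ := by
      simp [Measure.real, haar_interval]
    have hne : (bigM m a : ℂ) ≠ 0 := Nat.cast_ne_zero.2 (bigM_pos m a).ne'
    rw [this, Complex.real_smul]
    push_cast
    rw [inv_mul_cancel₀ hne, mul_one]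
  · refine (integrable_rademacherMartingale m c a).mul_bdd (c := 1)
      (Complex.continuous_conj.measurable.comp (measurable_psi m _)).aestronglyMeasurable
      (Eventually.of_forall fun x => ?_)
    simp [norm_psi]
  · exact ((integrable_const _).indicator (measurableSet_interval a 0)).const_mul _

/-- If a martingale does not change between the levels `b` and `a`, its partial sums up to `M_a`
are bounded in terms of `b`. -/
theorem norm_partialSum_le_of_eq (hm : ∀ k, 2 ≤ m k) {f : ℕ → Group m → ℂ}
    (hf : Martingale f (filtration m) (haar m)) {a b : ℕ} (hab : b ≤ a) (hfab : f a = f b) {G : ℝ}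
    (hG : ∀ x, ‖f b x‖ ≤ G) {j : ℕ} (hj : j ≤ bigM m a) (x : Group m) :
    ‖partialSum m f j x‖ ≤ bigM m b * G := by
  calc ‖partialSum m f j x‖ ≤ ∑ i ∈ Finset.range j, ‖fourierCoeff m f i‖ := by
        refine (norm_sum_le _ _).trans_eq ?_
        simp [norm_psi]
    _ ≤ ∑ i ∈ Finset.range (bigM m a), ‖fourierCoeff m f i‖ :=
        Finset.sum_le_sum_of_subset_of_nonneg (Finset.range_mono hj) fun _ _ _ => norm_nonneg _
    -- Frequencies from M_b up to M_a are computed from f^(a) = f^(b), hence vanish.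
    _ = ∑ i ∈ Finset.range (bigM m b), ‖fourierCoeff m f i‖ := by
        refine (Finset.sum_subset (Finset.range_mono (bigM_mono m hab)) fun i hi hi' => ?_).symm
        rw [Finset.mem_range] at hi hi'
        rw [fourierCoeff_eq m hm hf hi, hfab, integral_mul_conj_psi_eq_zero m hm (not_lt.1 hi')
          (dependsOn_of_stronglyMeasurable m (hf.1 b)), norm_zero]
    _ ≤ ∑ i ∈ Finset.range (bigM m b), G := by
        refine Finset.sum_le_sum fun i hi => ?_
        rw [fourierCoeff_eq m hm hf (Finset.mem_range.1 hi)]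
        refine (norm_integral_le_of_norm_le_const (C := G)
          (Eventually.of_forall fun x => ?_)).trans_eq (by simp)
        rw [norm_mul, RCLike.norm_conj, norm_psi, mul_one]
        exact hG x
    _ = bigM m b * G := by simp

/-- The index M_a + 2 makes k = M_a + 1 the last summand, with n - k = 1; S_{M_a+1} is the first
partial sum to contain ψ_{M_a}. -/
theorem le_norm_norlundLogMean (hm : ∀ k, 2 ≤ m k) {c : ℕ → ℝ} (hc : ∀ a, 0 ≤ c a) {a : ℕ}
    {E : ℝ} {x : Group m}
    (hE : ∀ j ≤ bigM m a, ‖partialSum m (rademacherMartingale m c) j x‖ ≤ E) :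
    c a / (∑ k ∈ Finset.Ico 1 (bigM m a + 2), (1 : ℝ) / k) - E ≤
      ‖norlundLogMean m (rademacherMartingale m c) (bigM m a + 2) x‖ := by
  set M := bigM m a with hM
  set f := rademacherMartingale m c with hf
  set l : ℂ := ∑ k ∈ Finset.Ico 1 (M + 2), (1 : ℂ) / k with hl
  have hlreal : l = ((∑ k ∈ Finset.Ico 1 (M + 2), (1 : ℝ) / k : ℝ) : ℂ) := by
    rw [hl]; push_cast; rfl
  have hl0 : 0 ≤ ∑ k ∈ Finset.Ico 1 (M + 2), (1 : ℝ) / k :=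
    Finset.sum_nonneg fun _ _ => by positivity
  have hE0 : 0 ≤ E := (norm_nonneg _).trans (hE 0 (Nat.zero_le _))
  -- The truncation `min k M` alters only the last summand, turning S_{M+1} into S_M; the rest is
  -- again a logarithmic mean.
  have hsplit : norlundLogMean m f (M + 2) x =
      (∑ k ∈ Finset.Ico 1 (M + 2), partialSum m f (min k M) x / (((M + 2 : ℕ) : ℂ) - k)) / l +
        c a * psi m M x / l := by
    have hM1 : 1 ≤ M + 1 := Nat.le_add_left 1 M
    rw [norlundLogMean, ← hl, ← add_div, Finset.sum_Ico_succ_top hM1, Finset.sum_Ico_succ_top hM1]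
    have hS : partialSum m f (M + 1) x = partialSum m f M x + c a * psi m M x := by
      rw [partialSum, Finset.sum_range_succ, hf, hM,
        fourierCoeff_rademacherMartingale_bigM m hm c a]
      rfl
    have h1 : ((M + 2 : ℕ) : ℂ) - ((M + 1 : ℕ) : ℂ) = 1 := by push_cast; ring
    rw [hS, h1, min_eq_right (Nat.le_add_right M 1), div_one, div_one, add_assoc]
    congr 2
    refine Finset.sum_congr rfl fun k hk => ?_
    rw [min_eq_left (Nat.lt_succ_iff.1 (Finset.mem_Ico.1 hk).2)]
  have hmain : ‖(c a : ℂ) * psi m M x / l‖ = c a / ∑ k ∈ Finset.Ico 1 (M + 2), (1 : ℝ) / k := by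
    rw [norm_div, norm_mul, norm_psi, mul_one, hlreal, Complex.norm_real, Complex.norm_real,
      Real.norm_of_nonneg (hc a), Real.norm_of_nonneg hl0]
  have herr := norm_logWeights_le (n := M + 2) (a := fun k => partialSum m f (min k M) x) hE0
    fun k _ => hE _ (min_le_right k M)
  rw [hsplit, ← hmain, add_comm]
  exact (sub_le_sub_left herr _).trans (norm_sub_le_norm_add _ _)

/-- f* is at most ∑ |c_a| M_a 1_{I_a(0)}, whose p-th power is integrated termwise. -/
theorem memHardy_rademacherMartingale (hm : ∀ k, 2 ≤ m k) {p : ℝ} (hp0 : 0 < p) (hp1 : p < 1)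
    {c : ℕ → ℝ}
    (hsum : ∑' a, ‖c a‖ₑ ^ p * (bigM m a : ℝ≥0∞) ^ (p - 1) < ∞) :
    MemHardy m p (rademacherMartingale m c) := by
  refine ⟨martingale_rademacherMartingale m hm c, ?_⟩
  rw [hardyNorm, eLpNorm_ofReal_eq _ hp0]
  refine ENNReal.rpow_lt_top_of_nonneg (by positivity) (lt_of_le_of_lt ?_ hsum).ne
  calc ∫⁻ x, maximalFunction m (rademacherMartingale m c) x ^ p ∂(haar m)
      ≤ ∫⁻ x, ∑' a, (interval m a 0).indicator
          (fun _ => (‖c a‖ₑ * (bigM m a : ℝ≥0∞)) ^ p) x ∂(haar m) := by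
        refine lintegral_mono fun x => ?_
        calc maximalFunction m (rademacherMartingale m c) x ^ p
            ≤ (∑' a, ‖c a‖ₑ * ‖rademacherDiff m a x‖ₑ) ^ p := by
              refine ENNReal.rpow_le_rpow (iSup_le fun n => ?_) hp0.le
              refine le_trans ?_ (ENNReal.sum_le_tsum (Finset.range n))
              refine (enorm_sum_le _ _).trans_eq (Finset.sum_congr rfl fun a _ => ?_)
              rw [enorm_mul, ← ofReal_norm (c a : ℂ), Complex.norm_real, ofReal_norm]
          _ ≤ _ := by
              refine (tsum_rpow_le hp0 hp1.le).trans_eq (tsum_congr fun a => ?_)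
              rw [enorm_rademacherDiff]
              by_cases hx : x ∈ interval m a 0 <;> simp [hx, hp0]
    _ = ∑' a, (‖c a‖ₑ * (bigM m a : ℝ≥0∞)) ^ p * (bigM m a : ℝ≥0∞)⁻¹ := by
        rw [lintegral_tsum fun a =>
          (measurable_const.indicator (measurableSet_interval a 0)).aemeasurable]
        refine tsum_congr fun a => ?_
        rw [lintegral_indicator_const (measurableSet_interval a 0), haar_interval]
    _ = _ := by
        refine tsum_congr fun a => ?_
        rw [ENNReal.mul_rpow_of_nonneg _ _ hp0.le, mul_assoc,
          ENNReal.rpow_sub _ _ (Nat.cast_ne_zero.2 (bigM_pos m a).ne')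
          (ENNReal.natCast_ne_top _), ENNReal.rpow_one, div_eq_mul_inv]

end Lacunary

/-! ### Part b): choice of the levels. -/

section Divergence

theorem sum_Ico_one_div_eq_harmonic (n : ℕ) :
    ∑ k ∈ Finset.Ico 1 (n + 1), (1 : ℝ) / k = (harmonic n : ℝ) := by
  rw [harmonic_eq_sum_Icc]
  push_cast
  simp only [one_div]
  rfl

variable (m : ℕ → ℕ) [∀ k, NeZero (m k)]

/-- Transfers the limsup from arbitrary n to the scale M_a: for M_{a+1} ≤ n < M_{a+2}, monotonicity
controls φ and the logarithm from above, while n ≤ B² M_a loses only a constant. -/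
theorem exists_level {B : ℕ} (hm : ∀ k, 2 ≤ m k) (hB : ∀ k, m k ≤ B) {q : ℝ} (hq : 0 < q)
    {φ : ℕ+ → ℝ} (hφ1 : ∀ n, 1 ≤ φ n) (hφ : Monotone φ)
    (hlim : limsup (fun n : ℕ+ =>
      (((n : ℝ) ^ q / (Real.log (n : ℝ) * φ n) : ℝ) : EReal)) atTop = ⊤)
    {R : ℝ} (hR : 0 ≤ R) (b : ℕ) :
    ∃ a, b ≤ a ∧ R * (∑ k ∈ Finset.Ico 1 (bigM m a + 2), (1 : ℝ) / k) *
      φ (bigM m a + 2).succPNat ≤ (bigM m a : ℝ) ^ q := by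
  -- The 2 pays for l ≤ 2 log n, the power of B² for passing from n^q to M_a^q.
  set T : ℝ := R * 2 * ((B : ℝ) ^ 2) ^ q with hT
  have hfreq := frequently_lt_of_lt_limsup (f := atTop) (u := fun n : ℕ+ =>
      (((n : ℝ) ^ q / (Real.log (n : ℝ) * φ n) : ℝ) : EReal)) (b := (T : EReal))
      (by isBoundedDefault) (by rw [hlim]; exact EReal.coe_lt_top T)
  obtain ⟨n, hnT, hn⟩ := (hfreq.and_eventually
    (eventually_ge_atTop (⟨bigM m (b + 3), bigM_pos m _⟩ : ℕ+))).exists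
  rw [EReal.coe_lt_coe_iff] at hnT
  replace hn : bigM m (b + 3) ≤ (n : ℕ) := hn
  have hex : ∃ N, (n : ℕ) < bigM m N := ⟨n, lt_bigM m hm n⟩
  have hlt := Nat.find_spec hex
  have hgt : b + 3 < Nat.find hex := by
    by_contra h
    exact absurd (hlt.trans_le (bigM_mono m (not_lt.1 h))) (not_lt.2 hn)
  -- Going down two levels gives 2 M_a ≤ n; as M_a ≥ 4, the argument M_a + 3 of φ stays below n.
  obtain ⟨a, ha⟩ : ∃ a, Nat.find hex = a + 2 := ⟨Nat.find hex - 2, by omega⟩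
  have hle : bigM m (a + 1) ≤ n := not_lt.1 (Nat.find_min hex (by omega))
  rw [ha] at hlt hgt
  have h4 : 4 ≤ bigM m a := (two_pow_le_bigM m hm 2).trans (bigM_mono m (by omega))
  have h2M : 2 * bigM m a ≤ n := (Nat.mul_le_mul_right _ (hm a)).trans hle
  have hnB : (n : ℕ) ≤ B ^ 2 * bigM m a := by
    refine hlt.le.trans ?_
    rw [bigM, bigM, ← mul_assoc, sq]
    exact Nat.mul_le_mul_right _ (Nat.mul_le_mul (hB _) (hB _))
  have hn8 : (8 : ℝ) ≤ n := by exact_mod_cast (by omega : 8 ≤ (n : ℕ))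
  have hlog : 1 ≤ Real.log n := by
    rw [Real.le_log_iff_exp_le (by linarith)]
    linarith [Real.exp_one_lt_d9]
  have hl : ∑ k ∈ Finset.Ico 1 (bigM m a + 2), (1 : ℝ) / k ≤ 2 * Real.log n := by
    rw [sum_Ico_one_div_eq_harmonic]
    refine (harmonic_le_one_add_log _).trans ?_
    have : Real.log ((bigM m a + 1 : ℕ) : ℝ) ≤ Real.log n :=
      Real.log_le_log (by positivity) (by exact_mod_cast (by omega : bigM m a + 1 ≤ (n : ℕ)))
    linarith
  have hφn : φ (bigM m a + 2).succPNat ≤ φ n := hφ (by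
    rw [← PNat.coe_le_coe, Nat.succPNat_coe]; omega)
  have hφ0 : 0 < φ n := one_pos.trans_le (hφ1 n)
  have hB0 : (0 : ℝ) < ((B : ℝ) ^ 2) ^ q := by
    have : 0 < B := (zero_lt_two.trans_le (hm 0)).trans_le (hB 0)
    positivity
  refine ⟨a, by omega, ?_⟩
  have h1 : T * (Real.log n * φ n) < (n : ℝ) ^ q :=
    (lt_div_iff₀ (by positivity)).1 hnT
  have h2 : (n : ℝ) ^ q ≤ ((B : ℝ) ^ 2) ^ q * (bigM m a : ℝ) ^ q := by
    rw [← Real.mul_rpow (by positivity) (by positivity)]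
    exact Real.rpow_le_rpow (by positivity) (by exact_mod_cast hnB) hq.le
  have h3 : R * (∑ k ∈ Finset.Ico 1 (bigM m a + 2), (1 : ℝ) / k) *
      φ (bigM m a + 2).succPNat ≤ R * (2 * Real.log n) * φ n := by
    have := (one_pos.trans_le (hφ1 (bigM m a + 2).succPNat)).le
    gcongr
  refine h3.trans (le_of_mul_le_mul_left ?_ hB0)
  calc ((B : ℝ) ^ 2) ^ q * (R * (2 * Real.log n) * φ n) = T * (Real.log n * φ n) := by
        rw [hT]; ring
    _ ≤ _ := h1.le.trans h2

/-- A martingale in `H_p` for which the weighted maximal operator is infinite everywhere. -/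
theorem exists_weightedMax_eq_top (hm : ∀ k, 2 ≤ m k) (hbdd : BddAbove (Set.range m)) {p : ℝ}
    (hp0 : 0 < p) (hp1 : p < 1) {φ : ℕ+ → ℝ} (hφ1 : ∀ n, 1 ≤ φ n) (hφ : Monotone φ)
    (hlim : limsup (fun n : ℕ+ =>
      (((n : ℝ) ^ (1 / p - 1) / (Real.log (n : ℝ) * φ n) : ℝ) : EReal)) atTop = ⊤) :
    ∃ f : ℕ → Group m → ℂ, MemHardy m p f ∧
      ∀ x, weightedMax m (fun n => φ n.succPNat) f x = ∞ := by
  obtain ⟨B, hB⟩ := hbdd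
  replace hB : ∀ k, m k ≤ B := fun k => hB ⟨k, rfl⟩
  set q : ℝ := 1 / p - 1 with hqdef
  have hq : 0 < q := by
    rw [hqdef, sub_pos, lt_div_iff₀ hp0]; linarith
  -- Chosen so that θ^p = 1/2: the H_p series becomes ∑ 2^(-k).
  set θ : ℝ := (1 / 2 : ℝ) ^ (1 / p) with hθ
  have hθ0 : 0 < θ := by positivity
  have hθ1 : θ ≤ 1 := Real.rpow_le_one (by norm_num) (by norm_num) (by positivity)
  have hθp : θ ^ p = 1 / 2 := by
    rw [hθ, ← Real.rpow_mul (by norm_num), one_div_mul_cancel hp0.ne', Real.rpow_one]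
  -- M_b coefficients, each at most sup |f^(b)| ≤ b M_b^q M_b. Only c_i ≤ M_i^q enters, so the
  -- levels can be chosen recursively before c is defined.
  let E : ℕ → ℝ := fun b => bigM m b * (b * ((bigM m b : ℝ) ^ q * bigM m b))
  have hE0 : ∀ b, 0 ≤ E b := fun b => by positivity
  have hstep : ∀ k a : ℕ, ∃ a', a < a' ∧ (k + 1 + E (a + 1)) *
      ((∑ i ∈ Finset.Ico 1 (bigM m a' + 2), (1 : ℝ) / i) * φ (bigM m a' + 2).succPNat) ≤
        θ ^ (k + 1) * (bigM m a' : ℝ) ^ q := by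
    intro k a
    have hR : 0 ≤ ((k : ℝ) + 1 + E (a + 1)) / θ ^ (k + 1) := by
      have := hE0 (a + 1)
      positivity
    obtain ⟨a', ha', h⟩ := exists_level m hm hB hq hφ1 hφ hlim hR (a + 1)
    refine ⟨a', ha', ?_⟩
    rw [mul_assoc, div_mul_eq_mul_div, div_le_iff₀ (by positivity)] at h
    rwa [mul_comm (θ ^ (k + 1))]
  choose g hg using hstep
  obtain ⟨α, hα⟩ : ∃ α : ℕ → ℕ, ∀ k, α (k + 1) = g k (α k) :=
    ⟨fun k => Nat.rec 0 (fun k a => g k a) k, fun _ => rfl⟩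
  have hmono : StrictMono α := strictMono_nat_of_lt_succ fun k => by
    rw [hα]; exact (hg k (α k)).1
  set c : ℕ → ℝ := Function.extend α (fun k => θ ^ k * (bigM m (α k) : ℝ) ^ q) 0 with hcdef
  have hcα : ∀ k, c (α k) = θ ^ k * (bigM m (α k) : ℝ) ^ q := hmono.injective.extend_apply _ _
  have hcz : ∀ a, (¬ ∃ k, α k = a) → c a = 0 := fun a ha => by
    rw [hcdef, Function.extend_apply' _ _ _ ha]; rfl
  have hc0 : ∀ a, 0 ≤ c a := fun a => by
    by_cases ha : ∃ k, α k = a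
    · obtain ⟨k, rfl⟩ := ha
      rw [hcα]; positivity
    · exact (hcz a ha).ge
  have hcle : ∀ a, c a ≤ (bigM m a : ℝ) ^ q := fun a => by
    by_cases ha : ∃ k, α k = a
    · obtain ⟨k, rfl⟩ := ha
      rw [hcα]
      exact mul_le_of_le_one_left (by positivity) (pow_le_one₀ hθ0.le hθ1)
    · rw [hcz a ha]; positivity
  set f := rademacherMartingale m c with hf
  have hmart := martingale_rademacherMartingale m hm c
  refine ⟨f, memHardy_rademacherMartingale m hm hp0 hp1 ?_, fun x => ?_⟩
  · rw [← hmono.injective.tsum_eq]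
    · have hterm : ∀ k, ‖c (α k)‖ₑ ^ p * (bigM m (α k) : ℝ≥0∞) ^ (p - 1) = (2⁻¹ : ℝ≥0∞) ^ k := by
        intro k
        have hM : (0 : ℝ) < bigM m (α k) := Nat.cast_pos.2 (bigM_pos m _)
        have hreal : c (α k) ^ p * (bigM m (α k) : ℝ) ^ (p - 1) = (1 / 2) ^ k := by
          rw [hcα, Real.mul_rpow (by positivity) (by positivity), ← Real.rpow_natCast θ k,
            ← Real.rpow_mul hθ0.le, mul_comm (k : ℝ) p, Real.rpow_mul hθ0.le, hθp,
            Real.rpow_natCast, mul_assoc, ← Real.rpow_mul hM.le, ← Real.rpow_add hM]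
          have : q * p + (p - 1) = 0 := by rw [hqdef]; field_simp; ring
          rw [this, Real.rpow_zero, mul_one]
        rw [Real.enorm_of_nonneg (hc0 _), ENNReal.ofReal_rpow_of_nonneg (hc0 _) hp0.le,
          ← ENNReal.ofReal_natCast, ENNReal.ofReal_rpow_of_pos hM,
          ← ENNReal.ofReal_mul (Real.rpow_nonneg (hc0 _) p), hreal,
          ENNReal.ofReal_pow (by norm_num), one_div, ENNReal.ofReal_inv_of_pos two_pos]
        simp
      simp only [hterm]
      rw [ENNReal.tsum_geometric, ENNReal.one_sub_inv_two, inv_inv]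
      exact ENNReal.ofNat_lt_top
    · intro a ha
      by_contra h
      refine ha ?_
      simp only [hcz a h, enorm_zero, ENNReal.zero_rpow_of_pos hp0, zero_mul]
  · refine ENNReal.eq_top_of_forall_nnreal_le fun r => ?_
    obtain ⟨k, hk⟩ := exists_nat_ge r
    set a := α (k + 1) with ha
    set b := α k + 1 with hb
    have hab : b ≤ a := hmono (Nat.lt_succ_self k)
    have hfab : f a = f b := by
      ext y
      refine (Finset.sum_subset (Finset.range_mono hab) fun i hi hi' => ?_).symm
      rw [hcz i, Complex.ofReal_zero, zero_mul]
      rintro ⟨j, rfl⟩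
      rw [Finset.mem_range] at hi hi'
      have h1 := hmono.lt_iff_lt.1 (show α j < α (k + 1) from hi)
      have h2 := hmono.lt_iff_lt.1 (show α k < α j by omega)
      omega
    have hG : ∀ y, ‖f b y‖ ≤ b * ((bigM m b : ℝ) ^ q * bigM m b) := fun y => by
      refine (norm_rademacherMartingale_le m hc0 b y).trans ?_
      rw [← nsmul_eq_mul, ← Finset.card_range b, ← Finset.sum_const, Finset.card_range]
      refine Finset.sum_le_sum fun i hi => ?_
      have hM : (bigM m i : ℝ) ≤ bigM m b :=
        Nat.cast_le.2 (bigM_mono m (Finset.mem_range.1 hi).le)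
      refine mul_le_mul ((hcle i).trans ?_) hM (by positivity) (by positivity)
      exact Real.rpow_le_rpow (by positivity) hM hq.le
    have hlow := le_norm_norlundLogMean m hm hc0 (a := a) (E := E b) (x := x)
      fun j hj => norm_partialSum_le_of_eq m hm hmart hab hfab hG hj x
    have hφa := hφ1 (bigM m a + 2).succPNat
    have hφa0 := one_pos.trans_le hφa
    have hl : 0 < ∑ i ∈ Finset.Ico 1 (bigM m a + 2), (1 : ℝ) / i := by
      refine Finset.sum_pos (fun i hi => ?_) ⟨1, by simp⟩
      have : 0 < i := (Finset.mem_Ico.1 hi).1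
      positivity
    have hbig : (k + 1 + E b) * φ (bigM m a + 2).succPNat ≤
        c a / ∑ i ∈ Finset.Ico 1 (bigM m a + 2), (1 : ℝ) / i := by
      rw [le_div_iff₀ hl, ha, hcα, hα, mul_assoc, mul_comm (φ _)]
      exact (hg k (α k)).2
    have hfin : (r : ℝ) * φ (bigM m a + 2).succPNat ≤ ‖norlundLogMean m f (bigM m a + 2) x‖ := by
      -- Since φ ≥ 1, the error is absorbed by the share E b of the main term.
      have hEφ : E b ≤ E b * φ (bigM m a + 2).succPNat := le_mul_of_one_le_right (hE0 b) hφa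
      have hrk : (r : ℝ) * φ (bigM m a + 2).succPNat ≤ (k + 1) * φ (bigM m a + 2).succPNat := by
        have : (r : ℝ) ≤ k := by exact_mod_cast hk
        exact mul_le_mul_of_nonneg_right (by linarith) hφa0.le
      rw [add_mul] at hbig
      linarith
    refine le_trans ?_ (le_iSup (fun n => ‖norlundLogMean m f n x‖ₑ /
      ENNReal.ofReal (φ n.succPNat)) (bigM m a + 2))
    rw [ENNReal.le_div_iff_mul_le (Or.inl (by simpa using hφa0)) (Or.inl ENNReal.ofReal_ne_top),
      ← ofReal_norm, ← ENNReal.ofReal_coe_nnreal, ← ENNReal.ofReal_mul r.coe_nonneg]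
    exact ENNReal.ofReal_le_ofReal hfin

end Divergence

end Vilenkin

theorem mainTheorem11 (m : ℕ → ℕ) [∀ k, NeZero (m k)] (hm : ∀ k, 2 ≤ m k)
    (hbdd : BddAbove (Set.range m)) (p : ℝ) (hp0 : 0 < p) (hp1 : p < 1) :
    Vilenkin.BoundedHardyLp m p
        (Vilenkin.weightedMax m fun n => ((n : ℝ) + 1) ^ (1 / p - 1)) ∧
      ∀ φ : ℕ+ → ℝ, (∀ n, 1 ≤ φ n) → Monotone φ →
        limsup (fun n : ℕ+ =>
          (((n : ℝ) ^ (1 / p - 1) / (Real.log (n : ℝ) * φ n) : ℝ) : EReal)) atTop = ⊤ →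
        ¬ Vilenkin.BoundedHardyLp m p (Vilenkin.weightedMax m fun n => φ n.succPNat) ∧
          ∃ f : ℕ → Vilenkin.Group m → ℂ, Vilenkin.MemHardy m p f ∧
            eLpNorm (Vilenkin.weightedMax m (fun n => φ n.succPNat) f)
              (ENNReal.ofReal p) (Vilenkin.haar m) = ∞ := by
  refine ⟨Vilenkin.boundedHardyLp_weightedMax m hm hbdd hp0 hp1, fun φ hφ1 hφ hlim => ?_⟩
  obtain ⟨f, hf, htop⟩ := Vilenkin.exists_weightedMax_eq_top m hm hbdd hp0 hp1 hφ1 hφ hlim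
  have hnorm : eLpNorm (Vilenkin.weightedMax m (fun n => φ n.succPNat) f)
      (ENNReal.ofReal p) (Vilenkin.haar m) = ∞ := by
    rw [Vilenkin.eLpNorm_ofReal_eq _ hp0]
    simp [htop, ENNReal.top_rpow_of_pos hp0, hp0]
  refine ⟨?_, f, hf, hnorm⟩
  rintro ⟨C, hC⟩
  have := hC f hf
  rw [hnorm, top_le_iff] at this
  exact ENNReal.mul_ne_top ENNReal.coe_ne_top hf.2.ne this
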